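/- **Setting.** Let $d, q$ be natural numbers and let $\mathcal P$ be the set of probability distributions of $(X,Y,Z)$ on $[0,1]\times[0,1]\times[0,1]^d$ that are absolutely continuous with respect to Lebesgue measure. Let $\mathcal H\subset\mathcal P$ be the set of those under which $X$ and $Y$ are conditionally independent given $Z$. Let $\mathcal P_0\subset\mathcal P$ and $\mathcal H_0=\mathcal P_0\cap\mathcal H$. For every $P\in\mathcal P_0$ fix (regular) conditional distributions of $X$ given $Z$ and of $Y$ given $Z$, with conditional distribution functions $F_{X\mid Z}(t\mid z)$, $F_{Y\mid Z}(t\mid z)$ and conditional quantile functions $Q(\tau\mid z)=\inf\{t\in[0,1]: F(t\mid z)\ge\tau\}$. Let $\phi=(\phi_1,\dots,\phi_q):[0,1]\to\mathbb R^q$ have linearly independent, Lipschitz continuous coordinates with $\int_0^1\phi_k(u)\,du=0$ and $\int_0^1\phi_k(u)^2\,du=1$, whose (closed) supports $\mathcal T_k$ are compact subsets of $(0,1)$. Put $\tau_{\min}=\inf\bigcup_k\mathcal T_k$ and $\tau_{\max}=\sup\bigcup_k\mathcal T_k$. For $f:[0,1]\times[0,1]^d\to\mathbb R$ let $$\|f\|_{\mathcal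 T,\infty}=\sup_{z\in[0,1]^d}\ \sup_{t\in[Q_{X\mid Z}(\tau_{\min}\mid z),\,Q_{X\mid Z}(\tau_{\max}\mid z)]}|f(t,z)|,$$ let $\|f\|_{\mathcal T^c,\infty}$ be the same with $t$ ranging over the complement in $[0,1]$ of that interval, and let $\|f\|'_{\mathcal T,\infty}$, $\|f\|'_{\mathcal T^c,\infty}$ be the same with $Q_{Y\mid Z}$ in place of $Q_{X\mid Z}$. Let $(X_i,Y_i,Z_i)_{i=1}^n$ be an i.i.d. sample from $P$. For every $n$ let $\hat F^{(n)}_{X\mid Z}$ be a measurable function of the sample $(X_i,Z_i)_{i=1}^n$ and $\hat F^{(n)}_{Y\mid Z}$ a measurable function of the sample $(Y_i,Z_i)_{i=1}^n$ (the same functions for all $P$), with values in the functions $(t,z)\mapsto\hat F(t\mid z)\in[0,1]$ that for each $z$ are continuous and increasing in $t\in[0,1]$ with $\hat F(0\mid z)=0$ and $\hat F(1\mid z)=1$. Write $D_n\in\mathcal O_P(a_n)$ if for every $\epsilon>0$ there is $M>0$ with $\sup_{n\ge1}P(|D_n|>M|a_n|)<\epsilon$, where $P$ is read as outer probability if $D_n$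 is not measurable. **Assumption.** For each $P\in\mathcal P_0$ there are deterministic rate functions $g_P,h_P$ tending to $0$ with $\sqrt n\,g_P(n)\,h_P(n)\to0$ as $n\to\infty$, and functions $\xi,\xi':[0,1]\times[0,1]^d\to\mathbb R$, such that 1. $\|F_{X\mid Z}-\hat F^{(n)}_{X\mid Z}\|_{\mathcal T,\infty}\in\mathcal O_P(g_P(n))$ and $\|F_{Y\mid Z}-\hat F^{(n)}_{Y\mid Z}\|'_{\mathcal T,\infty}\in\mathcal O_P(h_P(n))$; 2. $\|\xi-\hat F^{(n)}_{X\mid Z}\|_{\mathcal T^c,\infty}\in\mathcal O_P(g_P(n))$ and $\|\xi'-\hat F^{(n)}_{Y\mid Z}\|'_{\mathcal T^c,\infty}\in\mathcal O_P(h_P(n))$. **Theorem.** Let $\hat U_{1,i}=\hat F^{(n)}_{X\mid Z}(X_i\mid Z_i)$, $\hat U_{2,i}=\hat F^{(n)}_{Y\mid Z}(Y_i\mid Z_i)$ and $\hat\rho_n=\frac1n\sum_{i=1}^n\phi(\hat U_{1,i})\,\phi(\hat U_{2,i})^T$. Then for each fixed $P\in\mathcal H_0$ $$\sqrt n\,\hat\rho_n\Rightarrow_P\mathcal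 N(0,\Sigma\otimes\Sigma)$$ (convergence in distribution in $\mathbb R^{q\times q}$ as $n\to\infty$), where $\Sigma_{k,s}=\int_0^1\phi_k(u)\phi_s(u)\,du$ for $k,s=1,\dots,q$ does not depend on $P$, and $(\Sigma\otimes\Sigma)_{k\ell,st}=\Sigma_{ks}\Sigma_{\ell t}$. -/

import Mathlib

open MeasureTheory ProbabilityTheory Filter Topology unitInterval
open scoped ENNReal Kronecker Matrix

noncomputable section

namespace PartialCopula

/-! ### Observations and their distributions -/

/-- The cube `[0,1]^d` in which the conditioning variable `Z` takes its values. -/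
abbrev Cube (d : ℕ) : Type := Fin d → I

/-- The hypercube `[0,1]^(2+d)`, with points `(x, y, z)`. -/
abbrev Obs (d : ℕ) : Type := I × I × Cube d

/-- The coordinate `X`. -/
def xCoord {d : ℕ} (w : Obs d) : I := w.1

/-- The coordinate `Y`. -/
def yCoord {d : ℕ} (w : Obs d) : I := w.2.1

/-- The coordinate `Z`. -/
def zCoord {d : ℕ} (w : Obs d) : Cube d := w.2.2

lemma measurable_zCoord {d : ℕ} : Measurable (zCoord (d := d)) :=
  measurable_snd.comp measurable_snd

/-- The distributions on `[0,1]^(2+d)` that are absolutely continuous with respect to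
Lebesgue measure. -/
def acDistributions (d : ℕ) : Set (ProbabilityMeasure (Obs d)) :=
  {P | (P : Measure (Obs d)) ≪ volume}

/-- The absolutely continuous distributions under which `X` and `Y` are conditionally
independent given `Z`. -/
def condIndepDistributions (d : ℕ) : Set (ProbabilityMeasure (Obs d)) :=
  {P | P ∈ acDistributions d ∧
    CondIndepFun (MeasurableSpace.comap (zCoord (d := d)) inferInstance)
      measurable_zCoord.comap_le xCoord yCoord (P : Measure (Obs d))}

/-! ### Conditional distribution functions and conditional quantiles -/

/-- `κ` is a (regular) conditional distribution of `V` given `Z` when `(X, Y, Z) ∼ P`: each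
`κ z` is a probability measure on `[0,1]`, and the joint law of `(Z, V)` is the law of `Z`
followed by `κ`. -/
structure IsCondDistribution {d : ℕ} (P : Measure (Obs d)) (V : Obs d → I)
    (κ : Kernel (Cube d) I) : Prop where
  isMarkov : IsMarkovKernel κ
  disintegrate : P.map (fun w => (zCoord w, V w)) = (P.map zCoord) ⊗ₘ κ

/-- The conditional distribution function `F(t | z)`. -/
def condDistFun {d : ℕ} (κ : Kernel (Cube d) I) (t : I) (z : Cube d) : ℝ :=
  (κ z).real (Set.Iic t)

/-- The conditional quantile function `Q(τ | z) = inf {t ∈ [0,1] | F(t | z) ≥ τ}`. -/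
def condQuantile {d : ℕ} (κ : Kernel (Cube d) I) (τ : ℝ) (z : Cube d) : I :=
  sInf {t : I | τ ≤ condDistFun κ t z}

/-- An estimator of a conditional distribution function from `n` observations `(V_i, Z_i)`:
a measurable map sending a sample to a function `(t, z) ↦ F̂(t | z)` with values in `[0,1]`
that for every `z` is continuous and increasing in `t` from `F̂(0 | z) = 0` to
`F̂(1 | z) = 1`. -/
structure IsCDFEstimator {d n : ℕ} (F : (Fin n → I × Cube d) → I → Cube d → I) : Prop where
  measurable : Measurable fun p : (Fin n → I × Cube d) × I × Cube d => F p.1 p.2.1 p.2.2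
  continuous : ∀ s z, Continuous fun t => F s t z
  monotone : ∀ s z, Monotone fun t => F s t z
  map_zero : ∀ s z, F s 0 z = 0
  map_one : ∀ s z, F s 1 z = 1

/-! ### The functions defining the generalized correlation -/

/-- The standing assumptions on `φ = (φ_1, …, φ_q) : [0,1] → ℝ^q`. -/
structure IsTransform {q : ℕ} (φ : Fin q → I → ℝ) : Prop where
  isCompact_tsupport : ∀ k, IsCompact (tsupport (φ k))
  tsupport_subset : ∀ k, tsupport (φ k) ⊆ Set.Ioo 0 1
  lipschitz : ∀ k, ∃ L, LipschitzWith L (φ k)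
  integral_eq_zero : ∀ k, ∫ u : I, φ k u = 0
  integral_sq_eq_one : ∀ k, ∫ u : I, φ k u ^ 2 = 1
  linearIndependent : LinearIndependent ℝ φ

/-- `τ_min`, the infimum of the union of the supports. -/
def tauMin {q : ℕ} (φ : Fin q → I → ℝ) : ℝ :=
  ((sInf (⋃ k, tsupport (φ k)) : I) : ℝ)

/-- `τ_max`, the supremum of the union of the supports. -/
def tauMax {q : ℕ} (φ : Fin q → I → ℝ) : ℝ :=
  ((sSup (⋃ k, tsupport (φ k)) : I) : ℝ)

/-- The range `Q(𝒯 | z) = [Q(τ_min | z), Q(τ_max | z)]` of the central conditional quantiles,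
for `𝒯 = [τ_min, τ_max]`. -/
def centralRange {d q : ℕ} (φ : Fin q → I → ℝ) (κ : Kernel (Cube d) I) (z : Cube d) : Set I :=
  Set.Icc (condQuantile κ (tauMin φ) z) (condQuantile κ (tauMax φ) z)

/-- `Σ_{k,s} = ∫ φ_k φ_s`. -/
def covMatrix {q : ℕ} (φ : Fin q → I → ℝ) : Matrix (Fin q) (Fin q) ℝ :=
  fun k s => ∫ u : I, φ k u * φ s u

/-- The empirical generalized correlation `(1/n) ∑ φ(u_i) φ(v_i)ᵀ`. -/
def empiricalCorr {n q : ℕ} (φ : Fin q → I → ℝ) (u v : Fin n → I) :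
    Matrix (Fin q) (Fin q) ℝ :=
  (n : ℝ)⁻¹ • ∑ i, Matrix.vecMulVec (fun k => φ k (u i)) (fun k => φ k (v i))

/-! ### Stochastic orders and the assumption on the estimators -/

/-- `sup_z sup_{t ∈ S z} |f(t, z)|`, with values in `[0, ∞]`. -/
def supNormOn {d : ℕ} (S : Cube d → Set I) (f : I → Cube d → ℝ) : ℝ≥0∞ :=
  ⨆ z, ⨆ t ∈ S z, ENNReal.ofReal |f t z|

/-- `D_n ∈ O_P(a_n)`: for every `ε > 0` there is `M > 0` such that
`sup_{n ≥ 1} P(D_n > M |a_n|) < ε`. For a `D_n` that is not measurable this refers to the outer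
measure. -/
def IsBigOInProb {Ω : ℕ → Type} [∀ n, MeasurableSpace (Ω n)] (μ : ∀ n, Measure (Ω n))
    (D : ∀ n, Ω n → ℝ≥0∞) (a : ℕ → ℝ) : Prop :=
  ∀ ε : ℝ, 0 < ε → ∃ M : ℝ, 0 < M ∧
    (⨆ n, ⨆ _ : 1 ≤ n, μ n {ω | ENNReal.ofReal (M * |a n|) < D n ω}) < ENNReal.ofReal ε

/-- The law of an i.i.d. sample of size `n` from `P`. -/
abbrev sampleLaw {d : ℕ} (P : ProbabilityMeasure (Obs d)) (n : ℕ) : Measure (Fin n → Obs d) :=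
  Measure.pi fun _ => (P : Measure (Obs d))

/-- The subsample `(V_i, Z_i)` of a sample `(X_i, Y_i, Z_i)`. -/
def subsample {d n : ℕ} (V : Obs d → I) (w : Fin n → Obs d) : Fin n → I × Cube d :=
  fun i => (V (w i), zCoord (w i))

/-- Under `P`, the estimators `F̂⁽ⁿ⁾` of the conditional distribution function of `V` given `Z`
are consistent at rate `a` over the central conditional quantiles, and converge at rate `a` to
`ξ` over the tails. -/
structure IsConsistentAtRate {d q : ℕ} (φ : Fin q → I → ℝ) (P : ProbabilityMeasure (Obs d))
    (V : Obs d → I) (κ : Kernel (Cube d) I)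
    (F : (n : ℕ) → (Fin n → I × Cube d) → I → Cube d → I)
    (ξ : I → Cube d → ℝ) (a : ℕ → ℝ) : Prop where
  central : IsBigOInProb (sampleLaw P)
    (fun n w => supNormOn (centralRange φ κ)
      fun t z => condDistFun κ t z - (F n (subsample V w) t z : ℝ)) a
  tail : IsBigOInProb (sampleLaw P)
    (fun n w => supNormOn (fun z => (centralRange φ κ z)ᶜ)
      fun t z => ξ t z - (F n (subsample V w) t z : ℝ)) a

/-- The estimated nonparametric residuals `Û_i = F̂⁽ⁿ⁾(V_i | Z_i)`. -/
def residuals {d n : ℕ} (V : Obs d → I) (F : (Fin n → I × Cube d) → I → Cube d → I)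
    (w : Fin n → Obs d) : Fin n → I :=
  fun i => F (subsample V w) (V (w i)) (zCoord (w i))

/-- The statistic `√n ρ̂_n` as a vector of `ℝ^(q × q)`. -/
def scaledStatistic {d n q : ℕ} (φ : Fin q → I → ℝ)
    (FX FY : (Fin n → I × Cube d) → I → Cube d → I) (w : Fin n → Obs d) :
    EuclideanSpace ℝ (Fin q × Fin q) :=
  WithLp.toLp 2 fun p =>
    √(n : ℝ) * empiricalCorr φ (residuals xCoord FX w) (residuals yCoord FY w) p.1 p.2

/-- `Σ` is a Gram matrix, so that the Gaussian law with covariance matrix `Σ ⊗ Σ` is the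
genuine one. -/
lemma posSemidef_covMatrix_kronecker {q : ℕ} {φ : Fin q → I → ℝ} (hφ : IsTransform φ) :
    (covMatrix φ ⊗ₖ covMatrix φ).PosSemidef := by
  have hc : ∀ k, Continuous (φ k) := fun k => (hφ.lipschitz k).choose_spec.continuous
  have hint : ∀ f : I → ℝ, Continuous f → Integrable f := fun f hf =>
    hf.integrable_of_hasCompactSupport (HasCompactSupport.of_compactSpace f)
  have h : (covMatrix φ).PosSemidef := by
    refine Matrix.PosSemidef.of_dotProduct_mulVec_nonneg ?_ ?_
    · ext k s
      simp [covMatrix, mul_comm]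
    · intro x
      have : star x ⬝ᵥ covMatrix φ *ᵥ x = ∫ u : I, (∑ k, x k * φ k u) ^ 2 := by
        have e : ∀ u : I, (∑ k, x k * φ k u) ^ 2
            = ∑ k, ∑ s, x k * (φ k u * φ s u * x s) := by
          intro u
          rw [sq, Finset.sum_mul_sum]
          exact Finset.sum_congr rfl fun k _ => Finset.sum_congr rfl fun s _ => by ring
        simp_rw [e]
        rw [integral_finsetSum _ fun k _ => hint _ (by fun_prop)]
        simp only [dotProduct, Matrix.mulVec, covMatrix, Finset.mul_sum]
        refine Finset.sum_congr rfl fun k _ => ?_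
        rw [integral_finsetSum _ fun k _ => hint _ (by fun_prop)]
        refine Finset.sum_congr rfl fun s _ => ?_
        rw [integral_const_mul, integral_mul_const]
        simp
      rw [this]
      exact integral_nonneg fun u => sq_nonneg _
  exact h.kronecker h

end PartialCopula

end

open PartialCopula

namespace PartialCopula

/-! ### The probability integral transform on the unit interval -/

/-! Let `U₁ = F(X | Z)` and `U₂ = F(Y | Z)` be the true conditional ranks. Absolute continuity makes
the conditional laws atomless for almost every `z`, so by the probability integral transform and
conditional independence `U₂` is uniform and independent of `(X, Z)`; likewise `U₁` is uniform and
independent of `(Y, Z)` (`IsCondDistribution.map_prod_condRank`). Hence `(U₁, U₂)` is uniform on the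
square, and the oracle sum of `φ(U₁) φ(U₂)ᵀ` obeys the central limit theorem with covariance `Σ ⊗
Σ`.

Replacing true by estimated ranks adds three terms (`scaledStatistic_sub_apply`). In a cross term,
the errors of one estimator are functions of the `(X, Z)` sample alone, while the factors `φ(U₂)`
are i.i.d., centered and independent of that sample. Conditionally on it the second moment is the
mean squared error of the transformed ranks, so consistency without a rate is enough, and no sample
splitting is needed. The product of the two errors is bounded by `√n` times the product of the
maximal errors, and `√n g h → 0` applies.

The errors are uniformly small although `F̂` approximates `F` only on the central range: `φ` is
Lipschitz and vanishes outside `(τ_min, τ_max)`, and monotonicity of `F̂` carries the bounds at the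
two end quantiles into the tails (`IsTransform.abs_sub_le`). -/

lemma continuous_measureReal_Iic {ν : Measure I} [IsFiniteMeasure ν] (hν : ∀ x, ν {x} = 0) :
    Continuous fun t : I => ν.real (Set.Iic t) := by
  have e : (fun t : I => ν.real (Set.Iic t))
      = fun t => ∫ x, (Set.Iic t).indicator (fun _ => (1 : ℝ)) x ∂ν := by
    ext t
    rw [integral_indicator_const _ measurableSet_Iic]
    simp
  rw [e, continuous_iff_continuousAt]
  intro t
  refine continuousAt_of_dominated (bound := fun _ => 1) (.of_forall fun s => ?_)
    (.of_forall fun s => .of_forall fun x => ?_) (integrable_const _) ?_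
  · exact (measurable_const.indicator measurableSet_Iic).aestronglyMeasurable
  · by_cases h : x ∈ Set.Iic s <;> simp [h]
  -- For `x ≠ t` the indicator of `x ≤ s` is constant for `s` near `t`; only the null point `x = t`
  -- is lost.
  · have : ∀ᵐ x ∂ν, x ≠ t := by simpa [ae_iff] using hν t
    filter_upwards [this] with x hx
    rcases lt_or_gt_of_ne hx with h | h
    · refine (continuousAt_const (y := (1 : ℝ))).congr ?_
      filter_upwards [Ioi_mem_nhds h] with s hs
      rw [Set.indicator_of_mem (Set.mem_Iic.2 (le_of_lt hs))]
    · refine (continuousAt_const (y := (0 : ℝ))).congr ?_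
      filter_upwards [Iio_mem_nhds h] with s hs
      rw [Set.indicator_of_notMem (by simpa using hs)]

lemma monotone_measureReal_Iic {ν : Measure I} [IsFiniteMeasure ν] :
    Monotone fun t : I => ν.real (Set.Iic t) :=
  fun _ _ h => measureReal_mono (Set.Iic_subset_Iic.2 h)

lemma measureReal_Iic_zero {ν : Measure I} (hν : ∀ x, ν {x} = 0) :
    ν.real (Set.Iic (0 : I)) = 0 := by
  have : Set.Iic (0 : I) = {0} := by
    ext x
    simp
  simp [this, measureReal_def, hν]

lemma measureReal_Iic_one {ν : Measure I} [IsProbabilityMeasure ν] :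
    ν.real (Set.Iic (1 : I)) = 1 := by
  have : Set.Iic (1 : I) = Set.univ := by
    ext x
    simp [unitInterval.le_one']
  simp [this]

lemma exists_measureReal_Iic_eq {ν : Measure I} [IsProbabilityMeasure ν]
    (hν : ∀ x, ν {x} = 0) {τ : ℝ} (hτ : τ ∈ Set.Icc (0 : ℝ) 1) :
    ∃ t : I, ν.real (Set.Iic t) = τ := by
  have h := intermediate_value_Icc (zero_le_one (α := I)) (continuous_measureReal_Iic hν).continuousOn
  rw [measureReal_Iic_zero hν, measureReal_Iic_one] at h
  obtain ⟨t, -, ht⟩ := h hτ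
  exact ⟨t, ht⟩

/-- A measure on the unit interval without atoms is mapped to the uniform distribution by its
distribution function. -/
lemma map_measureReal_Iic_eq_volume {ν : Measure I} [IsProbabilityMeasure ν]
    (hν : ∀ x, ν {x} = 0) {G : I → I} (hG : ∀ t, (G t : ℝ) = ν.real (Set.Iic t)) :
    ν.map G = volume := by
  have hc : Continuous G := by
    rw [continuous_induced_rng]
    exact (continuous_measureReal_Iic hν).congr fun t => (hG t).symm
  have hm : Monotone G := fun s t h => by
    rw [← Subtype.coe_le_coe, hG, hG]
    exact monotone_measureReal_Iic h
  have := Measure.isProbabilityMeasure_map (μ := ν) hc.measurable.aemeasurable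
  refine Measure.ext_of_Iic _ _ fun u => ?_
  rw [Measure.map_apply hc.measurable measurableSet_Iic, unitInterval.volume_Iic]
  -- `G` may be flat, so it cannot be inverted. But `{G ≤ u}` is closed and downward closed, hence
  -- an initial segment, and `G` equals `u` at its last point because the value `u` is attained.
  obtain ⟨x, hx⟩ := exists_measureReal_Iic_eq hν u.2
  set S : Set I := G ⁻¹' Set.Iic u with hS
  have hxS : x ∈ S := by
    rw [hS, Set.mem_preimage, Set.mem_Iic, ← Subtype.coe_le_coe, hG, hx]
  have hcl : IsClosed S := isClosed_Iic.preimage hc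
  have hsup : sSup S ∈ S := hcl.isCompact.sSup_mem ⟨x, hxS⟩
  have e : S = Set.Iic (sSup S) := by
    refine Set.Subset.antisymm (fun y hy => le_sSup hy) fun y hy => ?_
    exact (hm hy).trans hsup
  have h1 : (G (sSup S) : ℝ) = u := by
    refine le_antisymm (Subtype.coe_le_coe.2 hsup) ?_
    rw [← hx, ← hG]
    exact Subtype.coe_le_coe.2 (hm (le_sSup hxS))
  rw [e, ← h1, hG, ofReal_measureReal]

/-! ### Conditional ranks -/

variable {d q : ℕ}

/-- The conditional distribution function `F(t | z)` with values in the unit interval. -/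
@[irreducible]
noncomputable def condRank (κ : Kernel (Cube d) I) (t : I) (z : Cube d) : I :=
  Set.projIcc 0 1 zero_le_one (condDistFun κ t z)

lemma coe_condRank {κ : Kernel (Cube d) I} [IsMarkovKernel κ] (t : I) (z : Cube d) :
    (condRank κ t z : ℝ) = condDistFun κ t z := by
  have h : condDistFun κ t z ∈ Set.Icc (0 : ℝ) 1 := ⟨measureReal_nonneg, measureReal_le_one⟩
  rw [condRank, Set.projIcc_of_mem zero_le_one h]

lemma measurable_condDistFun {κ : Kernel (Cube d) I} [IsMarkovKernel κ] :
    Measurable fun p : I × Cube d => condDistFun κ p.1 p.2 := by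
  let η : Kernel (I × Cube d) I := Kernel.prodMkLeft I κ
  have h : MeasurableSet {p : (I × Cube d) × I | p.2 ≤ p.1.1} :=
    measurableSet_le measurable_snd (measurable_fst.comp measurable_fst)
  exact (Kernel.measurable_kernel_prodMk_left (κ := η) h).ennreal_toReal

lemma measurable_condRank {κ : Kernel (Cube d) I} [IsMarkovKernel κ] :
    Measurable fun p : I × Cube d => condRank κ p.1 p.2 := by
  unfold condRank
  exact continuous_projIcc.measurable.comp measurable_condDistFun

lemma _root_.Measurable.condRank {α : Type*} [MeasurableSpace α] {κ : Kernel (Cube d) I}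
    [IsMarkovKernel κ] {f : α → I} {g : α → Cube d} (hf : Measurable f) (hg : Measurable g) :
    Measurable fun a => condRank κ (f a) (g a) :=
  measurable_condRank.comp (hf.prodMk hg)

/-- Continuity gives both halves: the superlevel set is closed, so its infimum belongs to it, and a
point where the value `τ` is attained bounds the infimum from above. -/
lemma condDistFun_condQuantile {κ : Kernel (Cube d) I} [IsMarkovKernel κ] {z : Cube d}
    (hz : ∀ x, κ z {x} = 0) {τ : ℝ} (hτ : τ ∈ Set.Icc (0 : ℝ) 1) :
    condDistFun κ (condQuantile κ τ z) z = τ := by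
  obtain ⟨x, hx⟩ := exists_measureReal_Iic_eq hz hτ
  have hcl : IsClosed {t : I | τ ≤ condDistFun κ t z} :=
    isClosed_le continuous_const (continuous_measureReal_Iic hz)
  refine le_antisymm ?_ (hcl.isCompact.sInf_mem ⟨x, hx.ge⟩)
  calc condDistFun κ (condQuantile κ τ z) z ≤ condDistFun κ x z :=
        monotone_measureReal_Iic (sInf_le (Set.mem_ofPred_eq ▸ hx.ge))
    _ = τ := hx

/-! ### Stability of the transformed ranks -/

namespace IsTransform

variable {φ : Fin q → I → ℝ}

lemma continuous (hφ : IsTransform φ) (k : Fin q) : Continuous (φ k) :=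
  (hφ.lipschitz k).choose_spec.continuous

lemma exists_lipschitz (hφ : IsTransform φ) :
    ∃ L : ℝ, 0 ≤ L ∧ ∀ k (u v : I), |φ k u - φ k v| ≤ L * |(u : ℝ) - v| := by
  choose L hL using hφ.lipschitz
  refine ⟨∑ k, (L k : ℝ), Finset.sum_nonneg fun k _ => (L k).2, fun k u v => ?_⟩
  have h := (hL k).dist_le_mul u v
  rw [Real.dist_eq, Subtype.dist_eq, Real.dist_eq] at h
  refine h.trans (mul_le_mul_of_nonneg_right ?_ (abs_nonneg _))
  exact Finset.single_le_sum (f := fun k => (L k : ℝ)) (fun k _ => (L k).2) (Finset.mem_univ k)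

lemma exists_bound (hφ : IsTransform φ) : ∃ C : ℝ, 0 ≤ C ∧ ∀ k u, |φ k u| ≤ C := by
  have h : ∀ k, ∃ C : ℝ, ∀ u, ‖φ k u‖ ≤ C := fun k => by
    obtain ⟨C, hC⟩ := isCompact_univ.exists_bound_of_continuousOn (hφ.continuous k).continuousOn
    exact ⟨C, fun u => hC u (Set.mem_univ u)⟩
  choose C hC using h
  refine ⟨∑ k, |C k|, Finset.sum_nonneg fun k _ => abs_nonneg _, fun k u => ?_⟩
  calc |φ k u| ≤ C k := hC k u
    _ ≤ |C k| := le_abs_self _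
    _ ≤ ∑ k, |C k| :=
      Finset.single_le_sum (f := fun k => |C k|) (fun k _ => abs_nonneg _) (Finset.mem_univ k)

lemma eq_zero_of_lt_tauMin (k : Fin q) {u : I} (hu : (u : ℝ) < tauMin φ) : φ k u = 0 := by
  by_contra h
  have : sInf (⋃ k, tsupport (φ k)) ≤ u :=
    sInf_le (Set.mem_iUnion.2 ⟨k, subset_tsupport _ h⟩)
  exact absurd hu (not_lt.2 (Subtype.coe_le_coe.2 this))

lemma eq_zero_of_tauMax_lt (k : Fin q) {u : I} (hu : tauMax φ < u) : φ k u = 0 := by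
  by_contra h
  have : u ≤ sSup (⋃ k, tsupport (φ k)) :=
    le_sSup (Set.mem_iUnion.2 ⟨k, subset_tsupport _ h⟩)
  exact absurd hu (not_lt.2 (Subtype.coe_le_coe.2 this))

/-- Only equality is new: if `φ k` were nonzero at `τ_min`, it would be nonzero slightly to the
left, where it vanishes. There is room on the left because the support avoids `0`. -/
lemma eq_zero_of_le_tauMin (hφ : IsTransform φ) (k : Fin q) {u : I}
    (hu : (u : ℝ) ≤ tauMin φ) : φ k u = 0 := by
  rcases hu.lt_or_eq with hu | hu
  · exact eq_zero_of_lt_tauMin k hu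
  by_contra h
  have h0 : (0 : I) < u := (hφ.tsupport_subset k (subset_tsupport _ h)).1
  have ho : IsOpen {v | φ k v ≠ 0} := isOpen_ne_fun (hφ.continuous k) continuous_const
  obtain ⟨v, hv, hvs⟩ := exists_Ioc_subset_of_mem_nhds (ho.mem_nhds h) ⟨0, h0⟩
  obtain ⟨w, hw1, hw2⟩ := exists_between hv
  exact hvs ⟨hw1, hw2.le⟩ (eq_zero_of_lt_tauMin k (hu ▸ Subtype.coe_lt_coe.2 hw2))

lemma eq_zero_of_tauMax_le (hφ : IsTransform φ) (k : Fin q) {u : I}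
    (hu : tauMax φ ≤ u) : φ k u = 0 := by
  rcases hu.lt_or_eq with hu | hu
  · exact eq_zero_of_tauMax_lt k hu
  by_contra h
  have h1 : u < (1 : I) := (hφ.tsupport_subset k (subset_tsupport _ h)).2
  have ho : IsOpen {v | φ k v ≠ 0} := isOpen_ne_fun (hφ.continuous k) continuous_const
  obtain ⟨v, hv, hvs⟩ := exists_Ico_subset_of_mem_nhds (ho.mem_nhds h) ⟨1, h1⟩
  obtain ⟨w, hw1, hw2⟩ := exists_between hv
  exact hvs ⟨hw1.le, hw2⟩ (eq_zero_of_tauMax_lt k (hu ▸ Subtype.coe_lt_coe.2 hw1))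

lemma tauMin_mem : tauMin φ ∈ Set.Icc (0 : ℝ) 1 := (sInf (⋃ k, tsupport (φ k)) : I).2

lemma tauMax_mem : tauMax φ ∈ Set.Icc (0 : ℝ) 1 := (sSup (⋃ k, tsupport (φ k)) : I).2

/-- The index `k` excludes `q = 0`, where the union is empty, `τ_min = 1` and `τ_max = 0`. Otherwise
the normalization of `φ k` forces a nonempty support. -/
lemma tauMin_le_tauMax (hφ : IsTransform φ) (k : Fin q) : tauMin φ ≤ tauMax φ := by
  have h : (⋃ k, tsupport (φ k)).Nonempty := by
    by_contra h
    have h0 : φ k = 0 := by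
      funext u
      by_contra hu
      exact h ⟨u, Set.mem_iUnion.2 ⟨k, subset_tsupport _ hu⟩⟩
    have := hφ.integral_sq_eq_one k
    simp [h0] at this
  exact Subtype.coe_le_coe.2 (sInf_le_sSup h)

/-- If a monotone function `F̂` is within `δ` of the conditional distribution function over the
central range, then the transformed ranks differ by at most `L δ`. -/
lemma abs_sub_le (hφ : IsTransform φ) {L : ℝ} (hL0 : 0 ≤ L)
    (hL : ∀ k (u v : I), |φ k u - φ k v| ≤ L * |(u : ℝ) - v|)
    {κ : Kernel (Cube d) I} [IsMarkovKernel κ] {z : Cube d} (hz : ∀ x, κ z {x} = 0)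
    {F : I → I} (hF : Monotone F) {δ : ℝ}
    (hδ : ∀ t ∈ centralRange φ κ z, |condDistFun κ t z - (F t : ℝ)| ≤ δ) (k : Fin q) (x : I) :
    |φ k (F x) - φ k (condRank κ x z)| ≤ L * δ := by
  set a := condQuantile κ (tauMin φ) z with ha
  set b := condQuantile κ (tauMax φ) z with hb
  have hFa : condDistFun κ a z = tauMin φ := condDistFun_condQuantile hz tauMin_mem
  have hFb : condDistFun κ b z = tauMax φ := condDistFun_condQuantile hz tauMax_mem
  have hmono : Monotone fun t => condDistFun κ t z := monotone_measureReal_Iic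
  have hab : a ≤ b := by
    refine sInf_le_sInf fun t ht => ?_
    exact (hφ.tauMin_le_tauMax k).trans ht
  have hδa := hδ a ⟨le_rfl, hab⟩
  have hδb := hδ b ⟨hab, le_rfl⟩
  have hδ0 : 0 ≤ δ := (abs_nonneg _).trans hδa
  rw [hFa] at hδa
  rw [hFb] at hδb
  have hra : (condRank κ a z : ℝ) = tauMin φ := by rw [coe_condRank, hFa]
  have hrb : (condRank κ b z : ℝ) = tauMax φ := by rw [coe_condRank, hFb]
  -- Below the central range the true rank is at most `τ_min`, so its transform is zero. By
  -- monotonicity `F x ≤ F a ≤ τ_min + δ`, so `F x` either lies where `φ k` vanishes or exceeds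
  -- `τ_min` by at most `δ`. The upper tail is symmetric.
  rcases lt_or_ge x a with hxa | hxa
  · have h0 : φ k (condRank κ x z) = 0 :=
      hφ.eq_zero_of_le_tauMin k (by rw [coe_condRank, ← hFa]; exact hmono hxa.le)
    rw [h0, sub_zero]
    rcases le_or_gt (F x : ℝ) (tauMin φ) with h | h
    · rw [hφ.eq_zero_of_le_tauMin k h, abs_zero]
      positivity
    · have h1 := hL k (F x) (condRank κ a z)
      rw [hφ.eq_zero_of_le_tauMin k hra.le, sub_zero, hra] at h1
      refine h1.trans (mul_le_mul_of_nonneg_left ?_ hL0)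
      have h2 : (F x : ℝ) ≤ F a := Subtype.coe_le_coe.2 (hF hxa.le)
      rw [abs_of_pos (sub_pos.2 h)]
      linarith [(abs_le.1 hδa).1]
  rcases lt_or_ge b x with hxb | hxb
  · have h0 : φ k (condRank κ x z) = 0 :=
      hφ.eq_zero_of_tauMax_le k (by rw [coe_condRank, ← hFb]; exact hmono hxb.le)
    rw [h0, sub_zero]
    rcases le_or_gt (tauMax φ) (F x : ℝ) with h | h
    · rw [hφ.eq_zero_of_tauMax_le k h, abs_zero]
      positivity
    · have h1 := hL k (F x) (condRank κ b z)
      rw [hφ.eq_zero_of_tauMax_le k hrb.ge, sub_zero, hrb] at h1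
      refine h1.trans (mul_le_mul_of_nonneg_left ?_ hL0)
      have h2 : (F b : ℝ) ≤ F x := Subtype.coe_le_coe.2 (hF hxb.le)
      rw [abs_of_neg (sub_neg.2 h)]
      linarith [(abs_le.1 hδb).2]
  · refine (hL k _ _).trans (mul_le_mul_of_nonneg_left ?_ hL0)
    rw [coe_condRank, abs_sub_comm]
    exact hδ x ⟨hxa, hxb⟩

end IsTransform

/-! ### Conditional distributions under an absolutely continuous law -/

lemma measurable_xCoord : Measurable (xCoord (d := d)) := measurable_fst

lemma measurable_yCoord : Measurable (yCoord (d := d)) := measurable_fst.comp measurable_snd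

/-- Pushing forward preserves absolute continuity, so this makes the law of `(Z, X)` absolutely
continuous with respect to Lebesgue measure. -/
lemma volume_map_zCoord_xCoord :
    (volume : Measure (Obs d)).map (fun w => (zCoord w, xCoord w)) = volume := by
  have h : (fun w : Obs d => (zCoord w, xCoord w)) = Prod.swap ∘ Prod.map id Prod.snd := rfl
  have h1 : MeasurePreserving (Prod.map id Prod.snd : Obs d → I × Cube d) :=
    (MeasurePreserving.id volume).prod measurePreserving_snd
  rw [h]
  exact (Measure.measurePreserving_swap.comp h1).map_eq

lemma volume_map_zCoord_yCoord :
    (volume : Measure (Obs d)).map (fun w => (zCoord w, yCoord w)) = volume := by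
  have h : (fun w : Obs d => (zCoord w, yCoord w)) = Prod.swap ∘ Prod.snd := rfl
  have h1 : MeasurePreserving (Prod.snd : Obs d → I × Cube d) := measurePreserving_snd
  rw [h]
  exact (Measure.measurePreserving_swap.comp h1).map_eq

/-- Conditional distributions have no atoms if the joint law is absolutely continuous. -/
lemma IsCondDistribution.ae_singleton_eq_zero {P : Measure (Obs d)} [IsProbabilityMeasure P]
    (hP : P ≪ volume)
    {V : Obs d → I} (hV : Measurable V)
    (hvol : (volume : Measure (Obs d)).map (fun w => (zCoord w, V w)) = volume)
    {κ : Kernel (Cube d) I} (hκ : IsCondDistribution P V κ) :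
    ∀ᵐ z ∂(P.map zCoord), ∀ x, κ z {x} = 0 := by
  have := hκ.isMarkov
  have hm : Measurable fun w => (zCoord w, V w) := measurable_zCoord.prodMk hV
  have hac : P.map (fun w => (zCoord w, V w)) ≪ (volume : Measure (Cube d × I)) := by
    rw [← hvol]
    exact hP.map hm
  let η : Kernel (Cube d × I) I := Kernel.prodMkRight I κ
  have hd : MeasurableSet {p : (Cube d × I) × I | p.2 = p.1.2} :=
    measurableSet_eq_fun measurable_snd (measurable_snd.comp measurable_fst)
  have hmeas : Measurable fun p : Cube d × I => κ p.1 {p.2} :=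
    Kernel.measurable_kernel_prodMk_left (κ := η) hd
  have hS : MeasurableSet {p : Cube d × I | κ p.1 {p.2} = 0} := hmeas (measurableSet_singleton 0)
  -- For fixed `z` the diagonal is null for `volume.prod (κ z)`, since Lebesgue measure has no
  -- atoms; slicing in the other direction shows that `κ z {x} = 0` for almost every `x`.
  have h1 : ∀ᵐ p ∂(volume : Measure (Cube d × I)), κ p.1 {p.2} = 0 := by
    refine (Measure.ae_prod_iff_ae_ae hS).2 (.of_forall fun z => ?_)
    have hd' : MeasurableSet {p : I × I | p.2 = p.1} :=
      measurableSet_eq_fun measurable_snd measurable_fst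
    have e : (volume.prod (κ z)) {p : I × I | p.2 = p.1} = 0 := by
      rw [Measure.prod_apply_symm hd']
      simp [Set.preimage]
    rw [Measure.prod_apply hd', lintegral_eq_zero_iff (measurable_measure_prodMk_left hd')] at e
    filter_upwards [e] with x hx
    simpa [Set.preimage] using hx
  have h2 := hac.ae_le h1
  rw [hκ.disintegrate] at h2
  have h3 := Measure.ae_ae_of_ae_compProd h2
  -- Now the set of atoms of `κ z` is null for `κ z` itself, so no point can carry mass.
  filter_upwards [h3] with z hz x
  by_contra hx
  exact hx ((ae_iff.1 hz |> fun h => measure_mono_null (Set.singleton_subset_iff.2 hx) h))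

/-- Under conditional independence given `Z`, the conditional distribution of `V'` given `(Z, V)`
is that given `Z`. -/
lemma IsCondDistribution.map_prod_eq_compProd {P : Measure (Obs d)} [IsProbabilityMeasure P]
    {V V' : Obs d → I} (hV : Measurable V) (hV' : Measurable V')
    (hind : CondIndepFun (MeasurableSpace.comap (zCoord (d := d)) inferInstance)
      measurable_zCoord.comap_le V V' P)
    {κ : Kernel (Cube d) I} (hκ : IsCondDistribution P V' κ) :
    P.map (fun w => ((zCoord w, V w), V' w))
      = (P.map fun w => (zCoord w, V w)) ⊗ₘ (Kernel.prodMkRight I κ) := by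
  have := hκ.isMarkov
  have hz := measurable_zCoord (d := d)
  have h1 := (condIndepFun_iff_condDistrib_prod_ae_eq_prodMkRight hV' hV hz).1 hind
  have h2 := condDistrib_ae_eq_of_measure_eq_compProd (μ := P) zCoord hV'.aemeasurable
    hκ.disintegrate
  have hfst : Measure.map Prod.fst (P.map fun w => (zCoord w, V w)) = P.map zCoord := by
    rw [Measure.map_map measurable_fst (hz.prodMk hV)]
    rfl
  rw [← compProd_map_condDistrib hV'.aemeasurable]
  refine Measure.compProd_congr (h1.trans ?_)
  rw [← hfst] at h2
  filter_upwards [ae_of_ae_map measurable_fst.aemeasurable h2] with p hp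
  simpa using hp

/-- Under conditional independence, the conditional rank of `V'` is uniform and independent of
`(V, Z)`. -/
lemma IsCondDistribution.map_prod_condRank {P : Measure (Obs d)} [IsProbabilityMeasure P]
    {V V' : Obs d → I} (hV : Measurable V) (hV' : Measurable V')
    (hind : CondIndepFun (MeasurableSpace.comap (zCoord (d := d)) inferInstance)
      measurable_zCoord.comap_le V V' P)
    {κ : Kernel (Cube d) I} (hκ : IsCondDistribution P V' κ)
    (hna : ∀ᵐ z ∂(P.map zCoord), ∀ x, κ z {x} = 0) :
    P.map (fun w => ((V w, zCoord w), condRank κ (V' w) (zCoord w)))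
      = (P.map fun w => (V w, zCoord w)).prod volume := by
  have := hκ.isMarkov
  have hz := measurable_zCoord (d := d)
  have hr : Measurable fun w => condRank κ (V' w) (zCoord w) :=
    hV'.condRank hz
  have hfst : Measure.map Prod.fst (P.map fun w => (zCoord w, V w)) = P.map zCoord := by
    rw [Measure.map_map measurable_fst (hz.prodMk hV)]
    rfl
  have hlaw := hκ.map_prod_eq_compProd hV hV' hind
  have : IsProbabilityMeasure (P.map fun w => (V w, zCoord w)) :=
    Measure.isProbabilityMeasure_map (hV.prodMk hz).aemeasurable
  refine (Measure.prod_eq fun s t hs ht => ?_).symm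
  have hR : Measurable fun p : (Cube d × I) × I => condRank κ p.2 p.1.1 :=
    measurable_snd.condRank (measurable_fst.comp measurable_fst)
  have hA : MeasurableSet {p : (Cube d × I) × I | p.1.swap ∈ s ∧ condRank κ p.2 p.1.1 ∈ t} :=
    ((measurable_swap.comp measurable_fst) hs).inter (hR ht)
  rw [Measure.map_apply ((hV.prodMk hz).prodMk hr) (hs.prod ht),
    Measure.map_apply (hV.prodMk hz) hs]
  have e1 : P ((fun w => ((V w, zCoord w), condRank κ (V' w) (zCoord w))) ⁻¹' s ×ˢ t)
      = P.map (fun w => ((zCoord w, V w), V' w))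
        {p : (Cube d × I) × I | p.1.swap ∈ s ∧ condRank κ p.2 p.1.1 ∈ t} := by
    rw [Measure.map_apply ((hz.prodMk hV).prodMk hV') hA]
    rfl
  rw [e1, hlaw, Measure.compProd_apply hA]
  have hna' : ∀ᵐ p ∂(P.map fun w => (zCoord w, V w)), ∀ x, κ p.1 {x} = 0 := by
    rw [← hfst] at hna
    exact ae_of_ae_map measurable_fst.aemeasurable hna
  -- Given `(Z, V) = p`, the probability integral transform for `κ p.1` makes the rank uniform
  -- whatever `p` is; this constancy is the independence.
  have e2 : ∀ᵐ p ∂(P.map fun w => (zCoord w, V w)),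
      (Kernel.prodMkRight I κ) p (Prod.mk p ⁻¹'
        {p : (Cube d × I) × I | p.1.swap ∈ s ∧ condRank κ p.2 p.1.1 ∈ t})
        = (Prod.swap ⁻¹' s).indicator (fun _ => volume t) p := by
    filter_upwards [hna'] with p hp
    by_cases hps : p.swap ∈ s
    · rw [Set.indicator_of_mem (by exact hps)]
      have := map_measureReal_Iic_eq_volume hp (G := fun x => condRank κ x p.1)
        (fun x => coe_condRank x p.1)
      rw [← this, Measure.map_apply _ ht]
      · simp [Set.preimage, hps]
      · exact measurable_id.condRank measurable_const
    · rw [Set.indicator_of_notMem (by exact hps)]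
      simp [Set.preimage, hps]
  rw [lintegral_congr_ae e2, lintegral_indicator (measurable_swap hs), lintegral_const,
    Measure.restrict_apply_univ, Measure.map_apply (hz.prodMk hV) (measurable_swap hs), mul_comm]
  rfl

/-! ### A multivariate central limit theorem for triangular statistics -/

section CentralLimit

variable {ι Ω : Type*} [Fintype ι] [DecidableEq ι] [MeasurableSpace Ω]

/-- The Cramér–Wold device: the scalar central limit theorem for each projection, evaluated at
frequency `1`, yields the vector statement. -/
lemma charFun_map_inner_one {E : Type*} [NormedAddCommGroup E] [InnerProductSpace ℝ E]
    [MeasurableSpace E] [BorelSpace E] [SecondCountableTopology E] {μ : Measure Ω} {Y : Ω → E}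
    (hY : AEMeasurable Y μ) (t : E) :
    charFun (μ.map Y) t = charFun (μ.map fun ω => inner ℝ (Y ω) t) 1 := by
  have hin : AEMeasurable (fun ω => inner ℝ (Y ω) t) μ := hY.inner_const
  rw [charFun_apply, charFun_apply_real, integral_map hY (by fun_prop), integral_map hin (by fun_prop)]
  simp

/-- **Multivariate central limit theorem** for centered random vectors. -/
theorem tendstoInDistribution_multivariateGaussian {P : Measure Ω} [IsProbabilityMeasure P]
    {ξ : ℕ → Ω → EuclideanSpace ℝ ι} (hindep : iIndepFun ξ P)
    (hident : ∀ i, IdentDistrib (ξ i) (ξ 0) P P) (hmem : MemLp (ξ 0) 2 P)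
    {S : Matrix ι ι ℝ} (hS : S.PosSemidef)
    (hmean : ∀ t, ∫ ω, inner ℝ (ξ 0 ω) t ∂P = 0)
    (hvar : ∀ t : EuclideanSpace ℝ ι, ∫ ω, inner ℝ (ξ 0 ω) t ^ 2 ∂P = t ⬝ᵥ S *ᵥ t) :
    TendstoInDistribution (fun (n : ℕ) ω => (√n)⁻¹ • ∑ k ∈ Finset.range n, ξ k ω) atTop
      (id : EuclideanSpace ℝ ι → EuclideanSpace ℝ ι) (fun _ => P) (multivariateGaussian 0 S) where
  forall_aemeasurable n := by
    have h : AEMeasurable (fun ω => ∑ k ∈ Finset.range n, ξ k ω) P :=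
      Finset.aemeasurable_fun_sum _ fun k _ => (hident k).aemeasurable_fst
    exact h.const_smul (√n)⁻¹
  tendsto := by
    refine ProbabilityMeasure.tendsto_iff_tendsto_charFun.2 fun t => ?_
    have hm : ∀ k, AEMeasurable (ξ k) P := fun k => (hident k).aemeasurable_fst
    have hg : Measurable fun x : EuclideanSpace ℝ ι => inner ℝ x t := by fun_prop
    have hmem' : MemLp (fun ω => inner ℝ (ξ 0 ω) t) 2 P := hmem.inner_const t
    have hv : Var[fun ω => inner ℝ (ξ 0 ω) t; P] = t ⬝ᵥ S *ᵥ t := by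
      rw [variance_eq_integral hmem'.aemeasurable, hmean, ← hvar]
      simp
    have h := tendstoInDistribution_inv_sqrt_mul_sum_sub (P := P)
      (P' := gaussianReal 0 (t ⬝ᵥ S *ᵥ t).toNNReal) (Y := id)
      (X := fun k ω => inner ℝ (ξ k ω) t) (by rw [hv]; exact HasLaw.id) hmem'
      (hindep.comp (fun _ x => inner ℝ x t) fun _ => hg) (fun k => (hident k).comp hg)
    have h1 := ProbabilityMeasure.tendsto_iff_tendsto_charFun.1 h.tendsto 1
    have hnn : 0 ≤ t ⬝ᵥ S *ᵥ t := by
      rw [← hvar]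
      exact integral_nonneg fun _ => sq_nonneg _
    have hlim : charFun (Measure.map (id : EuclideanSpace ℝ ι → EuclideanSpace ℝ ι)
        (multivariateGaussian 0 S)) t
        = charFun (Measure.map (id : ℝ → ℝ) (gaussianReal 0 (t ⬝ᵥ S *ᵥ t).toNNReal)) 1 := by
      rw [Measure.map_id, Measure.map_id, charFun_multivariateGaussian hS, charFun_gaussianReal]
      simp [hnn]
    simp only [ProbabilityMeasure.coe_mk] at h1 ⊢
    rw [hlim]
    refine h1.congr fun n => ?_
    rw [charFun_map_inner_one (Y := fun ω => (√n)⁻¹ • ∑ k ∈ Finset.range n, ξ k ω) ?_ t]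
    · congr 2
      ext ω
      rw [hmean, real_inner_smul_left, sum_inner]
      simp
    · exact (Finset.aemeasurable_fun_sum _ fun k _ => hm k).const_smul (√n)⁻¹

/-- The first `n` coordinates of an i.i.d. sequence are an i.i.d. sample of size `n`. -/
lemma infinitePi_map_fin (P : Measure Ω) [IsProbabilityMeasure P] (n : ℕ) :
    (Measure.infinitePi fun _ : ℕ => P).map (fun ω (i : Fin n) => ω i)
      = Measure.pi fun _ : Fin n => P := by
  refine (Measure.pi_eq fun s hs => ?_).symm
  rw [Measure.map_apply (by fun_prop) (.univ_pi hs)]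
  set T : ℕ → Set Ω := fun k => if h : k < n then s ⟨k, h⟩ else Set.univ with hT
  have hTm : ∀ k, MeasurableSet (T k) := fun k => by
    by_cases h : k < n <;> simp [hT, h, hs]
  have e : (fun (ω : ℕ → Ω) (i : Fin n) => ω i) ⁻¹' Set.univ.pi s
      = Set.pi (Finset.range n) T := by
    ext ω
    simp only [Set.mem_preimage, Set.mem_pi, Set.mem_univ, true_imp_iff, Finset.coe_range,
      Set.mem_Iio]
    constructor
    · intro h k hk
      simpa [hT, hk] using h ⟨k, hk⟩
    · intro h i
      simpa [hT] using h i i.2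
  rw [e, Measure.infinitePi_pi _ fun k _ => hTm k, Finset.prod_range]
  simp [hT]

/-- A statistic of an i.i.d. sample that differs from a normalized sum of centered vectors by a
term that vanishes in probability is asymptotically normal. -/
theorem tendstoInDistribution_of_sub_normalized_sum {P : Measure Ω} [IsProbabilityMeasure P]
    {ξ : Ω → EuclideanSpace ℝ ι} (hξ : Measurable ξ) (hmem : MemLp ξ 2 P)
    {S : Matrix ι ι ℝ} (hS : S.PosSemidef)
    (hmean : ∀ t, ∫ ω, inner ℝ (ξ ω) t ∂P = 0)
    (hvar : ∀ t : EuclideanSpace ℝ ι, ∫ ω, inner ℝ (ξ ω) t ^ 2 ∂P = t ⬝ᵥ S *ᵥ t)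
    {T : (n : ℕ) → (Fin n → Ω) → EuclideanSpace ℝ ι} (hT : ∀ n, Measurable (T n))
    (hconv : ∀ ε : ℝ, 0 < ε → Tendsto (fun n : ℕ => (Measure.pi fun _ : Fin n => P)
      {w | ε ≤ ‖T n w - (√n)⁻¹ • ∑ i, ξ (w i)‖}) atTop (𝓝 0)) :
    TendstoInDistribution T atTop (id : EuclideanSpace ℝ ι → EuclideanSpace ℝ ι)
      (fun n => Measure.pi fun _ : Fin n => P) (multivariateGaussian 0 S) := by
  -- The statistics live on different spaces. Slutsky's argument is run on one sequence space, whose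
  -- first `n` coordinates reproduce the sample law.
  let Q : Measure (ℕ → Ω) := Measure.infinitePi fun _ : ℕ => P
  let r : (n : ℕ) → (ℕ → Ω) → Fin n → Ω := fun n ω i => ω i
  have hr : ∀ n, Measurable (r n) := fun n => by fun_prop
  have hmp : ∀ k, MeasurePreserving (fun ω : ℕ → Ω => ω k) Q P := fun k =>
    measurePreserving_eval_infinitePi (fun _ : ℕ => P) k
  have hclt := tendstoInDistribution_multivariateGaussian (P := Q) (ξ := fun k ω => ξ (ω k))
    (iIndepFun_infinitePi fun _ => hξ)
    (fun k => ⟨(hξ.comp (measurable_pi_apply k)).aemeasurable,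
      (hξ.comp (measurable_pi_apply 0)).aemeasurable, by
        change Q.map (ξ ∘ fun ω => ω k) = Q.map (ξ ∘ fun ω => ω 0)
        rw [← Measure.map_map hξ (hmp k).measurable, ← Measure.map_map hξ (hmp 0).measurable,
          (hmp k).map_eq, (hmp 0).map_eq]⟩)
    (hmem.comp_measurePreserving (hmp 0)) hS
    (fun t => by
      rw [← hmean t, ← (hmp 0).map_eq, integral_map (hmp 0).measurable.aemeasurable (by fun_prop)])
    (fun t => by
      rw [← hvar t, ← (hmp 0).map_eq, integral_map (hmp 0).measurable.aemeasurable (by fun_prop)])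
  have hmain := tendstoInDistribution_of_tendstoInMeasure_sub
    (Y := fun n ω => T n (r n ω)) (Z := id) hclt ?_ fun n => ((hT n).comp (hr n)).aemeasurable
  · refine ⟨fun n => (hT n).aemeasurable, aemeasurable_id, ?_⟩
    refine hmain.tendsto.congr fun n => ?_
    refine Subtype.ext ?_
    change Q.map (T n ∘ r n) = _
    rw [← Measure.map_map (hT n) (hr n), infinitePi_map_fin]
  · rw [tendstoInMeasure_iff_norm]
    intro ε hε
    refine (hconv ε hε).congr fun n => ?_
    rw [← infinitePi_map_fin, Measure.map_apply (hr n)]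
    · simp [Q, r, Set.preimage, Finset.sum_range]
    · have : Measurable fun w : Fin n → Ω => T n w - (√n)⁻¹ • ∑ i, ξ (w i) := by fun_prop
      exact measurableSet_le measurable_const this.norm

end CentralLimit

/-! ### Convergence in probability along a sequence of probability spaces -/

section InProbability

variable {Ω : ℕ → Type} [∀ n, MeasurableSpace (Ω n)]

/-- `R_n` converges to `0` in probability. -/
def VanishesInProb (μ : ∀ n, Measure (Ω n)) (R : ∀ n, Ω n → ℝ) : Prop :=
  ∀ ε : ℝ, 0 < ε → Tendsto (fun n => μ n {w | ε ≤ |R n w|}) atTop (𝓝 0)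

/-- The maximum of `|A_{n,1}|, …, |A_{n,n}|` is of order `g n` in probability. -/
def IsUniformBigOInProb (μ : ∀ n, Measure (Ω n)) (A : ∀ n, Ω n → Fin n → ℝ) (g : ℕ → ℝ) : Prop :=
  ∀ η : ℝ, 0 < η → ∃ M : ℝ, 0 < M ∧
    ∀ n, 1 ≤ n → μ n {w | ∃ i, M * |g n| < |A n w i|} ≤ ENNReal.ofReal η

variable {μ : ∀ n, Measure (Ω n)}

lemma VanishesInProb.add {R S : ∀ n, Ω n → ℝ} (hR : VanishesInProb μ R)
    (hS : VanishesInProb μ S) : VanishesInProb μ fun n w => R n w + S n w := by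
  intro ε hε
  have h := (hR (ε / 2) (by positivity)).add (hS (ε / 2) (by positivity))
  rw [add_zero] at h
  refine tendsto_of_tendsto_of_tendsto_of_le_of_le tendsto_const_nhds h (fun _ => zero_le)
    fun n => (measure_mono fun w hw => ?_).trans (measure_union_le _ _)
  by_contra hc
  simp only [Set.mem_union, Set.mem_ofPred_eq, not_or, not_le] at hc hw
  have := abs_add_le (R n w) (S n w)
  linarith [hc.1, hc.2]

/-- Convergence in probability of a random vector follows from that of its coordinates. -/
lemma tendsto_measure_norm_of_vanishesInProb {ι : Type*} [Fintype ι]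
    {R : ∀ n, Ω n → EuclideanSpace ℝ ι} (hR : ∀ p, VanishesInProb μ fun n w => R n w p)
    {ε : ℝ} (hε : 0 < ε) : Tendsto (fun n => μ n {w | ε ≤ ‖R n w‖}) atTop (𝓝 0) := by
  -- The `+ 1` makes `card ι * c < ε` strict and covers an empty index type.
  set c : ℝ := ε / (Fintype.card ι + 1) with hc
  have hc0 : 0 < c := by positivity
  have h := tendsto_finsetSum (Finset.univ : Finset ι) fun p _ => hR p c hc0
  rw [Finset.sum_const_zero] at h
  refine tendsto_of_tendsto_of_tendsto_of_le_of_le tendsto_const_nhds h (fun _ => zero_le)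
    fun n => ?_
  refine (measure_mono (t := ⋃ p ∈ (Finset.univ : Finset ι), {w | c ≤ |R n w p|})
    fun w hw => ?_).trans (measure_biUnion_finset_le _ _)
  by_contra hcon
  simp only [Set.mem_iUnion, Finset.mem_univ, Set.mem_ofPred_eq, exists_prop, true_and, not_exists,
    not_le] at hcon hw
  have h1 : ‖R n w‖ ≤ ∑ p, |R n w p| := by
    rw [EuclideanSpace.norm_eq]
    refine Real.sqrt_le_iff.2 ⟨Finset.sum_nonneg fun p _ => abs_nonneg _, ?_⟩
    exact Finset.sum_sq_le_sq_sum_of_nonneg fun p _ => abs_nonneg _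
  have h2 : ∑ p, |R n w p| ≤ ∑ _p : ι, c := Finset.sum_le_sum fun p _ => (hcon p).le
  rw [Finset.sum_const, Finset.card_univ, nsmul_eq_mul] at h2
  have h3 : (Fintype.card ι : ℝ) * c < ε := by
    have : (Fintype.card ι + 1 : ℝ) * c = ε := by
      rw [hc]
      field_simp
    linarith
  linarith

/-- The normalized sum of products of terms of orders `g n` and `h n` vanishes if
`√n g(n) h(n) → 0`. -/
lemma IsUniformBigOInProb.vanishesInProb_sum_mul {A B : ∀ n, Ω n → Fin n → ℝ} {g h : ℕ → ℝ}
    (hA : IsUniformBigOInProb μ A g) (hB : IsUniformBigOInProb μ B h)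
    (hgh : Tendsto (fun n : ℕ => √(n : ℝ) * g n * h n) atTop (𝓝 0)) :
    VanishesInProb μ fun n w => (√(n : ℝ))⁻¹ * ∑ i, A n w i * B n w i := by
  intro ε hε
  rw [ENNReal.tendsto_nhds_zero]
  intro δ hδ
  obtain ⟨η, hη0, hη⟩ : ∃ η : ℝ, 0 < η ∧ ENNReal.ofReal η + ENNReal.ofReal η ≤ δ := by
    rcases eq_or_ne δ ⊤ with rfl | hδt
    · exact ⟨1, one_pos, le_top⟩
    · refine ⟨δ.toReal / 2, half_pos (ENNReal.toReal_pos hδ.ne' hδt), ?_⟩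
      have := ENNReal.toReal_nonneg (a := δ)
      rw [← ENNReal.ofReal_add (by positivity) (by positivity), add_halves,
        ENNReal.ofReal_toReal hδt]
  obtain ⟨M, hM, hM'⟩ := hA η hη0
  obtain ⟨N, hN, hN'⟩ := hB η hη0
  have hlim : Tendsto (fun n : ℕ => M * N * |√(n : ℝ) * g n * h n|) atTop (𝓝 0) := by
    simpa using (hgh.abs).const_mul (M * N)
  filter_upwards [hlim.eventually (gt_mem_nhds hε), eventually_ge_atTop 1] with n hn hn1
  -- Off the two exceptional events each of the `n` products is at most `M |g n| * N |h n|`, and `n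
  -- / √n = √n`.
  refine le_trans (measure_mono fun w hw => ?_) <| (measure_union_le _ _).trans <|
    (add_le_add (hM' n hn1) (hN' n hn1)).trans hη
  by_contra hc
  simp only [Set.mem_union, Set.mem_ofPred_eq, not_or, not_exists, not_lt] at hc hw
  have hs : 0 < √(n : ℝ) := Real.sqrt_pos.2 (by exact_mod_cast hn1)
  have h1 : |∑ i, A n w i * B n w i| ≤ n * (M * |g n| * (N * |h n|)) := by
    refine (Finset.abs_sum_le_sum_abs _ _).trans ?_
    calc ∑ i, |A n w i * B n w i| ≤ ∑ _i : Fin n, M * |g n| * (N * |h n|) := by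
          refine Finset.sum_le_sum fun i _ => ?_
          rw [abs_mul]
          exact mul_le_mul (hc.1 i) (hc.2 i) (abs_nonneg _) (by positivity)
      _ = n * (M * |g n| * (N * |h n|)) := by simp
  have h2 : |(√(n : ℝ))⁻¹ * ∑ i, A n w i * B n w i| ≤ M * N * |√(n : ℝ) * g n * h n| := by
    rw [abs_mul, abs_of_pos (inv_pos.2 hs)]
    calc (√(n : ℝ))⁻¹ * |∑ i, A n w i * B n w i|
        ≤ (√(n : ℝ))⁻¹ * (n * (M * |g n| * (N * |h n|))) :=
          mul_le_mul_of_nonneg_left h1 (inv_pos.2 hs).le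
      _ = (√(n : ℝ))⁻¹ * (√(n : ℝ) * √(n : ℝ) * (M * |g n| * (N * |h n|))) := by
          rw [Real.mul_self_sqrt (Nat.cast_nonneg n)]
      _ = M * N * |√(n : ℝ) * g n * h n| := by
          rw [abs_mul, abs_mul, abs_of_pos hs]
          field_simp
  linarith

end InProbability

/-! ### Sums weighted by independent centered variables -/

section Weighted

variable {Ω α β : Type} [MeasurableSpace Ω] [MeasurableSpace α] [MeasurableSpace β]

lemma integral_pi_mul {n : ℕ} {ν : Measure β} [IsProbabilityMeasure ν] {W : β → ℝ}
    (hW : Measurable W) (h0 : ∫ u, W u ∂ν = 0) (h1 : ∫ u, W u ^ 2 ∂ν = 1) (i j : Fin n) :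
    ∫ u : Fin n → β, W (u i) * W (u j) ∂(Measure.pi fun _ => ν) = if i = j then 1 else 0 := by
  have he : ∀ (k : Fin n) (f : β → ℝ), Measurable f →
      ∫ u : Fin n → β, f (u k) ∂(Measure.pi fun _ => ν) = ∫ u, f u ∂ν := fun k f hf => by
    have h := integral_map (μ := Measure.pi fun _ : Fin n => ν) (f := f)
      (measurable_pi_apply k).aemeasurable hf.aestronglyMeasurable
    rw [(measurePreserving_eval (fun _ : Fin n => ν) k).map_eq] at h
    exact h.symm
  split_ifs with h
  · subst h
    rw [← h1, ← he i _ (hW.pow_const 2)]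
    simp_rw [sq]
  · have hind := (iIndepFun_pi (μ := fun _ : Fin n => ν) (X := fun _ => W)
      fun _ => hW.aemeasurable).indepFun h
    rw [hind.integral_fun_mul_eq_mul_integral
      (hW.comp (measurable_pi_apply i)).aestronglyMeasurable
      (hW.comp (measurable_pi_apply j)).aestronglyMeasurable, he i W hW, h0, zero_mul]

/-- The sample of pairs `(T, G)` with `G` independent of `T` splits into independent samples. -/
lemma measurePreserving_pi_of_map_prod {P : Measure Ω} [IsProbabilityMeasure P] {ν : Measure β}
    [IsProbabilityMeasure ν] {T : Ω → α} {G : Ω → β} (hT : Measurable T) (hG : Measurable G)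
    (hlaw : P.map (fun w => (T w, G w)) = (P.map T).prod ν) (n : ℕ) :
    MeasurePreserving (fun (w : Fin n → Ω) => (fun i => T (w i), fun i => G (w i)))
      (Measure.pi fun _ => P)
      ((Measure.pi fun _ : Fin n => P.map T).prod (Measure.pi fun _ : Fin n => ν)) := by
  have : IsProbabilityMeasure (P.map T) := Measure.isProbabilityMeasure_map hT.aemeasurable
  have h1 := measurePreserving_arrowProdEquivProdArrow α β (Fin n) (fun _ => P.map T) fun _ => ν
  have h2 : MeasurePreserving (fun (w : Fin n → Ω) i => (T (w i), G (w i)))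
      (Measure.pi fun _ => P) (Measure.pi fun _ => (P.map T).prod ν) := by
    refine ⟨by fun_prop, ?_⟩
    have : IsProbabilityMeasure (P.map fun w => (T w, G w)) :=
      Measure.isProbabilityMeasure_map (hT.prodMk hG).aemeasurable
    rw [Measure.pi_map_pi (f := fun _ w => (T w, G w)) fun _ => (hT.prodMk hG).aemeasurable, hlaw]
  exact h1.comp h2

/-- The weights may depend on the whole `T`-sample but not on the `G`-sample, so by Fubini each term
of the expanded square factors. The variables `W (G (w i))` are orthonormal, which leaves only the
diagonal. Boundedness serves integrability. -/
lemma integral_sq_sum_weighted {P : Measure Ω} [IsProbabilityMeasure P] {ν : Measure β}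
    [IsProbabilityMeasure ν] {T : Ω → α} {G : Ω → β} (hT : Measurable T) (hG : Measurable G)
    (hlaw : P.map (fun w => (T w, G w)) = (P.map T).prod ν) {W : β → ℝ}
    (hW : Measurable W) {K : ℝ} (hK : ∀ u, |W u| ≤ K)
    (h0 : ∫ u, W u ∂ν = 0) (h1 : ∫ u, W u ^ 2 ∂ν = 1) {n : ℕ} {A : (Fin n → α) → Fin n → ℝ}
    (hA : ∀ i, Measurable fun x => A x i) {C : ℝ} (hC : ∀ x i, |A x i| ≤ C) :
    ∫ w, (∑ i, A (fun j => T (w j)) i * W (G (w i))) ^ 2 ∂(Measure.pi fun _ : Fin n => P)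
      = ∑ i, ∫ w, A (fun j => T (w j)) i ^ 2 ∂(Measure.pi fun _ : Fin n => P) := by
  have : IsProbabilityMeasure (P.map T) := Measure.isProbabilityMeasure_map hT.aemeasurable
  have hmp := measurePreserving_pi_of_map_prod hT hG hlaw n
  set π := Measure.pi fun _ : Fin n => P.map T
  set ρ := Measure.pi fun _ : Fin n => ν
  have hch : ∀ f : (Fin n → α) × (Fin n → β) → ℝ, Measurable f →
      ∫ w, f (fun j => T (w j), fun j => G (w j)) ∂(Measure.pi fun _ : Fin n => P)
        = ∫ p, f p ∂(π.prod ρ) := fun f hf => by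
    rw [← hmp.map_eq, integral_map hmp.measurable.aemeasurable hf.aestronglyMeasurable]
  have hA2 : ∀ i j, Measurable fun x => A x i * A x j := fun i j => (hA i).mul (hA j)
  have hW2 : ∀ i j, Measurable fun u : Fin n → β => W (u i) * W (u j) := fun i j => by fun_prop
  have hmeas : ∀ i j, Measurable fun p : (Fin n → α) × (Fin n → β) =>
      (A p.1 i * A p.1 j) * (W (p.2 i) * W (p.2 j)) := fun i j =>
    ((hA2 i j).comp measurable_fst).mul ((hW2 i j).comp measurable_snd)
  have hint : ∀ i j, Integrable (fun p : (Fin n → α) × (Fin n → β) =>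
      (A p.1 i * A p.1 j) * (W (p.2 i) * W (p.2 j))) (π.prod ρ) := fun i j => by
    refine Integrable.of_bound (hmeas i j).aestronglyMeasurable (C * C * (K * K))
      (.of_forall fun p => ?_)
    rw [Real.norm_eq_abs, abs_mul, abs_mul, abs_mul]
    have hC0 : 0 ≤ C := (abs_nonneg _).trans (hC p.1 i)
    have hK0 : 0 ≤ K := (abs_nonneg _).trans (hK (p.2 i))
    exact mul_le_mul (mul_le_mul (hC _ _) (hC _ _) (abs_nonneg _) hC0)
      (mul_le_mul (hK _) (hK _) (abs_nonneg _) hK0) (by positivity) (by positivity)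
  have e : ∀ p : (Fin n → α) × (Fin n → β), (∑ i, A p.1 i * W (p.2 i)) ^ 2
      = ∑ i, ∑ j, (A p.1 i * A p.1 j) * (W (p.2 i) * W (p.2 j)) := fun p => by
    rw [sq, Finset.sum_mul_sum]
    exact Finset.sum_congr rfl fun i _ => Finset.sum_congr rfl fun j _ => by ring
  rw [hch (fun p => (∑ i, A p.1 i * W (p.2 i)) ^ 2)
    ((Finset.measurable_sum _ fun i _ => ((hA i).comp measurable_fst).mul
      (by fun_prop)).pow_const 2)]
  simp_rw [e]
  rw [integral_finsetSum _ fun i _ => integrable_finsetSum _ fun j _ => hint i j]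
  refine Finset.sum_congr rfl fun i _ => ?_
  rw [integral_finsetSum _ fun j _ => hint i j]
  rw [hch (fun p => A p.1 i ^ 2) (((hA i).comp measurable_fst).pow_const 2)]
  have e2 : ∀ j, ∫ p, (A p.1 i * A p.1 j) * (W (p.2 i) * W (p.2 j)) ∂(π.prod ρ)
      = (∫ x, A x i * A x j ∂π) * if i = j then 1 else 0 := fun j => by
    rw [← integral_pi_mul hW h0 h1 i j]
    exact integral_prod_mul (μ := π) (ν := ρ) (fun x => A x i * A x j)
      fun u => W (u i) * W (u j)
  simp_rw [e2, mul_ite, mul_one, mul_zero]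
  rw [Finset.sum_ite_eq Finset.univ i, if_pos (Finset.mem_univ i)]
  have e3 := integral_prod_mul (μ := π) (ν := ρ) (fun x => A x i ^ 2) fun _ => (1 : ℝ)
  simp only [mul_one, integral_const, probReal_univ, smul_eq_mul] at e3
  rw [e3]
  simp_rw [sq]

/-- A normalized sum with small bounded weights depending on `T` of centered variables
independent of `T` vanishes in probability. -/
lemma IsUniformBigOInProb.vanishesInProb_sum_weighted {P : Measure Ω} [IsProbabilityMeasure P]
    {ν : Measure β} [IsProbabilityMeasure ν] {T : Ω → α} {G : Ω → β} (hT : Measurable T)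
    (hG : Measurable G) (hlaw : P.map (fun w => (T w, G w)) = (P.map T).prod ν) {W : β → ℝ}
    (hW : Measurable W) {K : ℝ} (hK : ∀ u, |W u| ≤ K)
    (h0 : ∫ u, W u ∂ν = 0) (h1 : ∫ u, W u ^ 2 ∂ν = 1) {A : ∀ n, (Fin n → α) → Fin n → ℝ}
    (hA : ∀ n i, Measurable fun x => A n x i) {C : ℝ} (hC : ∀ n x i, |A n x i| ≤ C) {g : ℕ → ℝ}
    (hg : Tendsto g atTop (𝓝 0))
    (hsmall : IsUniformBigOInProb (fun n => Measure.pi fun _ : Fin n => P)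
      (fun n w => A n fun j => T (w j)) g) :
    VanishesInProb (fun n => Measure.pi fun _ : Fin n => P)
      fun n w => (√(n : ℝ))⁻¹ * ∑ i, A n (fun j => T (w j)) i * W (G (w i)) := by
  intro ε hε
  rw [← ENNReal.tendsto_toReal_zero_iff fun n => measure_ne_top _ _]
  -- Chebyshev's inequality, with each squared weight split according to the event that some weight
  -- exceeds `M |g n|`: at most `(M |g n|) ^ 2` off it, and at most `C ^ 2` on it, which has
  -- probability at most `η`.
  have key : ∀ η : ℝ, 0 < η → ∃ M : ℝ, 0 < M ∧ ∀ n : ℕ, 1 ≤ n →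
      (Measure.pi fun _ : Fin n => P).real
        {w | ε ≤ |(√(n : ℝ))⁻¹ * ∑ i, A n (fun j => T (w j)) i * W (G (w i))|}
        ≤ (ε ^ 2)⁻¹ * ((M * |g n|) ^ 2 + C ^ 2 * η) := by
    intro η hη
    obtain ⟨M, hM, hM'⟩ := hsmall η hη
    refine ⟨M, hM, fun n hn => ?_⟩
    have hn0 : (0 : ℝ) < n := by exact_mod_cast hn
    set μ := Measure.pi fun _ : Fin n => P with hμ
    have hTm : Measurable fun (w : Fin n → Ω) j => T (w j) := by fun_prop
    have hAm : ∀ i, Measurable fun w : Fin n → Ω => A n (fun j => T (w j)) i :=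
      fun i => (hA n i).comp hTm
    set bad : Set (Fin n → Ω) := {w | ∃ i, M * |g n| < |A n (fun j => T (w j)) i|} with hbad
    have hbm : MeasurableSet bad := by
      have : bad = ⋃ i, {w | M * |g n| < |A n (fun j => T (w j)) i|} := by
        ext w
        simp [hbad]
      rw [this]
      exact .iUnion fun i => measurableSet_lt measurable_const (hAm i).abs
    have hbr : μ.real bad ≤ η := ENNReal.toReal_le_of_le_ofReal hη.le (hM' n hn)
    have hAi : ∀ i, ∫ w, A n (fun j => T (w j)) i ^ 2 ∂μ ≤ (M * |g n|) ^ 2 + C ^ 2 * η := by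
      intro i
      have hle : ∀ w, A n (fun j => T (w j)) i ^ 2
          ≤ (M * |g n|) ^ 2 + bad.indicator (fun _ => C ^ 2) w := fun w => by
        rw [← sq_abs]
        by_cases hw : w ∈ bad
        · rw [Set.indicator_of_mem hw]
          have := pow_le_pow_left₀ (abs_nonneg _) (hC n (fun j => T (w j)) i) 2
          nlinarith [sq_nonneg (M * |g n|)]
        · rw [Set.indicator_of_notMem hw, add_zero]
          simp only [hbad, Set.mem_ofPred_eq, not_exists, not_lt] at hw
          exact pow_le_pow_left₀ (abs_nonneg _) (hw i) 2
      calc ∫ w, A n (fun j => T (w j)) i ^ 2 ∂μ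
          ≤ ∫ w, ((M * |g n|) ^ 2 + bad.indicator (fun _ => C ^ 2) w) ∂μ :=
            integral_mono_of_nonneg (.of_forall fun w => sq_nonneg _)
              ((integrable_const _).add ((integrable_const _).indicator hbm)) (.of_forall hle)
        _ = (M * |g n|) ^ 2 + C ^ 2 * μ.real bad := by
            rw [integral_add (integrable_const _) ((integrable_const _).indicator hbm),
              integral_indicator_const _ hbm]
            simp [mul_comm]
        _ ≤ (M * |g n|) ^ 2 + C ^ 2 * η := by
            gcongr
    have hsum := integral_sq_sum_weighted hT hG hlaw hW hK h0 h1 (hA n) (hC n)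
    have hcheb := mul_meas_ge_le_integral_of_nonneg (μ := μ)
      (f := fun w => ((√(n : ℝ))⁻¹ * ∑ i, A n (fun j => T (w j)) i * W (G (w i))) ^ 2)
      (.of_forall fun w => sq_nonneg _) ?_ (ε ^ 2)
    · have hset : {w : Fin n → Ω |
          ε ≤ |(√(n : ℝ))⁻¹ * ∑ i, A n (fun j => T (w j)) i * W (G (w i))|}
          = {w | ε ^ 2 ≤ ((√(n : ℝ))⁻¹ * ∑ i, A n (fun j => T (w j)) i * W (G (w i))) ^ 2} := by
        ext w
        rw [Set.mem_ofPred_eq, Set.mem_ofPred_eq, sq_le_sq, abs_of_pos hε]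
      rw [hset, ← div_eq_inv_mul, le_div_iff₀' (by positivity)]
      refine hcheb.trans ?_
      simp_rw [mul_pow, inv_pow, Real.sq_sqrt hn0.le]
      rw [integral_const_mul, hsum]
      calc (n : ℝ)⁻¹ * ∑ i, ∫ w, A n (fun j => T (w j)) i ^ 2 ∂μ
          ≤ (n : ℝ)⁻¹ * ∑ _i : Fin n, ((M * |g n|) ^ 2 + C ^ 2 * η) :=
            mul_le_mul_of_nonneg_left (Finset.sum_le_sum fun i _ => hAi i) (by positivity)
        _ = M ^ 2 * |g n| ^ 2 + C ^ 2 * η := by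
            rw [Finset.sum_const, Finset.card_univ, Fintype.card_fin, nsmul_eq_mul, mul_pow]
            field_simp
    · refine Integrable.of_bound (Measurable.aestronglyMeasurable ?_)
        (((√(n : ℝ))⁻¹ * (n * (C * K))) ^ 2) (.of_forall fun w => ?_)
      · exact ((Finset.measurable_sum _ fun i _ => (hAm i).mul (by fun_prop)).const_mul _).pow_const 2
      · have hb : |∑ i, A n (fun j => T (w j)) i * W (G (w i))| ≤ n * (C * K) := by
          refine (Finset.abs_sum_le_sum_abs _ _).trans ?_
          calc ∑ i, |A n (fun j => T (w j)) i * W (G (w i))| ≤ ∑ _i : Fin n, C * K := by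
                refine Finset.sum_le_sum fun i _ => ?_
                rw [abs_mul]
                exact mul_le_mul (hC _ _ _) (hK _) (abs_nonneg _)
                  ((abs_nonneg _).trans (hC n (fun j => T (w j)) i))
            _ = n * (C * K) := by simp
        rw [Real.norm_eq_abs, abs_pow, abs_mul, abs_of_nonneg (inv_nonneg.2 (Real.sqrt_nonneg _))]
        gcongr
  refine tendsto_order.2 ⟨fun a ha => .of_forall fun n => ha.trans_le ENNReal.toReal_nonneg,
    fun δ hδ => ?_⟩
  -- Chosen so that the exceptional event contributes at most `δ / 2`; the `+ 1` allows `C = 0`.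
  have hη : 0 < δ * ε ^ 2 / (2 * (C ^ 2 + 1)) := by positivity
  obtain ⟨M, hM, hb⟩ := key _ hη
  have hlim : Tendsto (fun n => (ε ^ 2)⁻¹ * (M * |g n|) ^ 2) atTop (𝓝 0) := by
    simpa using (((hg.abs).const_mul M).pow 2).const_mul (ε ^ 2)⁻¹
  filter_upwards [hlim.eventually (gt_mem_nhds (half_pos hδ)), eventually_ge_atTop 1] with n hn hn1
  refine (hb n hn1).trans_lt ?_
  have : (ε ^ 2)⁻¹ * (C ^ 2 * (δ * ε ^ 2 / (2 * (C ^ 2 + 1)))) ≤ δ / 2 := by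
    have e : (ε ^ 2)⁻¹ * (C ^ 2 * (δ * ε ^ 2 / (2 * (C ^ 2 + 1))))
        = δ / 2 * (C ^ 2 / (C ^ 2 + 1)) := by
      field_simp
    rw [e]
    have : C ^ 2 / (C ^ 2 + 1) ≤ 1 := (div_le_one (by positivity)).2 (by linarith)
    nlinarith
  rw [mul_add]
  linarith

end Weighted

/-! ### Errors of the estimated ranks -/

/-- The errors `φ_k(F̂(v_i | z_i)) - φ_k(F(v_i | z_i))` of the transformed estimated ranks. -/
noncomputable def rankError (φ : Fin q → I → ℝ) (κ : Kernel (Cube d) I)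
    (F : (n : ℕ) → (Fin n → I × Cube d) → I → Cube d → I) (k : Fin q) (n : ℕ)
    (s : Fin n → I × Cube d) (i : Fin n) : ℝ :=
  φ k (F n s (s i).1 (s i).2) - φ k (condRank κ (s i).1 (s i).2)

lemma IsCDFEstimator.measurable_eval {n : ℕ} {F : (Fin n → I × Cube d) → I → Cube d → I}
    (hF : IsCDFEstimator F) (i : Fin n) : Measurable fun s => F s (s i).1 (s i).2 :=
  hF.measurable.comp (g := fun p : (Fin n → I × Cube d) × I × Cube d => F p.1 p.2.1 p.2.2)
    (measurable_id.prodMk (measurable_pi_apply i))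

lemma measurable_rankError {φ : Fin q → I → ℝ} (hφ : IsTransform φ) {κ : Kernel (Cube d) I}
    [IsMarkovKernel κ] {F : (n : ℕ) → (Fin n → I × Cube d) → I → Cube d → I}
    (hF : ∀ n, IsCDFEstimator (F n)) (k : Fin q) (n : ℕ) (i : Fin n) :
    Measurable fun s => rankError φ κ F k n s i := by
  have h1 : Measurable fun s : Fin n → I × Cube d => (s i).1 :=
    measurable_fst.comp (measurable_pi_apply i)
  have h2 : Measurable fun s : Fin n → I × Cube d => (s i).2 :=
    measurable_snd.comp (measurable_pi_apply i)
  have h3 := (hφ.continuous k).measurable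
  exact (h3.comp ((hF n).measurable_eval i)).sub (h3.comp (h1.condRank h2))

lemma abs_le_of_supNormOn_le {S : Cube d → Set I} {f : I → Cube d → ℝ} {δ : ℝ} (hδ : 0 ≤ δ)
    (h : supNormOn S f ≤ ENNReal.ofReal δ) {z : Cube d} {t : I} (ht : t ∈ S z) : |f t z| ≤ δ := by
  refine (ENNReal.ofReal_le_ofReal_iff hδ).1 (le_trans ?_ h)
  exact le_trans (le_iSup₂ (f := fun t (_ : t ∈ S z) => ENNReal.ofReal |f t z|) t ht)
    (le_iSup (fun z => ⨆ t ∈ S z, ENNReal.ofReal |f t z|) z)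

/-- The errors of the transformed estimated ranks inherit the rate of the estimator. -/
lemma IsConsistentAtRate.isUniformBigOInProb_rankError {φ : Fin q → I → ℝ} (hφ : IsTransform φ)
    {P : ProbabilityMeasure (Obs d)} {V : Obs d → I} {κ : Kernel (Cube d) I} [IsMarkovKernel κ]
    {F : (n : ℕ) → (Fin n → I × Cube d) → I → Cube d → I} (hF : ∀ n, IsCDFEstimator (F n))
    {ξ : I → Cube d → ℝ} {g : ℕ → ℝ} (hcons : IsConsistentAtRate φ P V κ F ξ g)
    (hna : ∀ᵐ z ∂((P : Measure (Obs d)).map zCoord), ∀ x, κ z {x} = 0) (k : Fin q) :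
    IsUniformBigOInProb (sampleLaw P) (fun n w => rankError φ κ F k n (subsample V w)) g := by
  obtain ⟨L, hL0, hL⟩ := hφ.exists_lipschitz
  intro η hη
  obtain ⟨M, hM, hM'⟩ := hcons.central η hη
  -- The `+ 1` keeps the constant positive when `L = 0`.
  refine ⟨L * M + 1, by positivity, fun n hn => ?_⟩
  have hgood : ∀ᵐ w ∂(sampleLaw P n), ∀ i, ∀ x, κ (zCoord (w i)) {x} = 0 := by
    refine ae_all_iff.2 fun i => ?_
    exact (Measure.quasiMeasurePreserving_eval (fun _ : Fin n => (P : Measure (Obs d))) i).ae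
      (ae_of_ae_map measurable_zCoord.aemeasurable hna)
  have hle := (le_iSup₂ (f := fun n (_ : 1 ≤ n) => sampleLaw P n {w | ENNReal.ofReal (M * |g n|)
    < supNormOn (centralRange φ κ)
      fun t z => condDistFun κ t z - (F n (subsample V w) t z : ℝ)}) n hn).trans hM'.le
  -- The inclusion of events holds only almost surely, because atoms are excluded only for almost
  -- every `z`.
  refine le_trans (measure_mono_ae ?_) hle
  filter_upwards [hgood] with w hw
  rintro ⟨i, hi⟩
  by_contra hcon
  have hsup : supNormOn (centralRange φ κ)
      (fun t z => condDistFun κ t z - (F n (subsample V w) t z : ℝ))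
      ≤ ENNReal.ofReal (M * |g n|) := not_lt.1 hcon
  have hδ : 0 ≤ M * |g n| := by positivity
  have := hφ.abs_sub_le hL0 hL (hw i) ((hF n).monotone (subsample V w) (zCoord (w i)))
    (fun t ht => abs_le_of_supNormOn_le hδ hsup ht) k (V (w i))
  have h2 : |rankError φ κ F k n (subsample V w) i| ≤ L * (M * |g n|) := this
  nlinarith [abs_nonneg (g n)]

/-- The cross terms between the errors of one estimator and the ranks of the other variable
vanish in probability. -/
lemma IsConsistentAtRate.vanishesInProb_cross {φ : Fin q → I → ℝ} (hφ : IsTransform φ)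
    {P : ProbabilityMeasure (Obs d)} {V G : Obs d → I} (hV : Measurable V) (hG : Measurable G)
    {κ : Kernel (Cube d) I} [IsMarkovKernel κ]
    {F : (n : ℕ) → (Fin n → I × Cube d) → I → Cube d → I} (hF : ∀ n, IsCDFEstimator (F n))
    {ξ : I → Cube d → ℝ} {g : ℕ → ℝ} (hg : Tendsto g atTop (𝓝 0))
    (hcons : IsConsistentAtRate φ P V κ F ξ g)
    (hna : ∀ᵐ z ∂((P : Measure (Obs d)).map zCoord), ∀ x, κ z {x} = 0)
    (hlaw : (P : Measure (Obs d)).map (fun w => ((V w, zCoord w), G w))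
      = ((P : Measure (Obs d)).map fun w => (V w, zCoord w)).prod volume) (k l : Fin q) :
    VanishesInProb (sampleLaw P) fun n w =>
      (√(n : ℝ))⁻¹ * ∑ i, rankError φ κ F k n (subsample V w) i * φ l (G (w i)) := by
  obtain ⟨C, hC0, hC⟩ := hφ.exists_bound
  refine IsUniformBigOInProb.vanishesInProb_sum_weighted (ν := volume)
    (T := fun w => (V w, zCoord w)) (hV.prodMk measurable_zCoord) hG hlaw
    (hφ.continuous l).measurable (hC l) (hφ.integral_eq_zero l) (hφ.integral_sq_eq_one l)
    (A := fun n => rankError φ κ F k n) (fun n i => measurable_rankError hφ hF k n i)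
    (C := C + C) (fun n x i => ?_) hg (hcons.isUniformBigOInProb_rankError hφ hF hna k)
  exact (abs_sub _ _).trans (add_le_add (hC k _) (hC k _))

/-! ### The oracle statistic -/

/-- The vector `φ(u) φ(v)ᵀ`. -/
noncomputable def outerTransform (φ : Fin q → I → ℝ) (u v : I) :
    EuclideanSpace ℝ (Fin q × Fin q) :=
  WithLp.toLp 2 fun p => φ p.1 u * φ p.2 v

lemma IsTransform.integrable_mul {φ : Fin q → I → ℝ} (hφ : IsTransform φ) (k s : Fin q) :
    Integrable fun u => φ k u * φ s u :=
  ((hφ.continuous k).mul (hφ.continuous s)).integrable_of_hasCompactSupport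
    (HasCompactSupport.of_compactSpace _)

lemma IsTransform.integrable {φ : Fin q → I → ℝ} (hφ : IsTransform φ) (k : Fin q) :
    Integrable (φ k) :=
  (hφ.continuous k).integrable_of_hasCompactSupport (HasCompactSupport.of_compactSpace _)

lemma IsTransform.continuous_outerTransform {φ : Fin q → I → ℝ} (hφ : IsTransform φ) :
    Continuous fun p : I × I => outerTransform φ p.1 p.2 := by
  refine (PiLp.continuous_toLp 2 _).comp (continuous_pi fun p => ?_)
  exact ((hφ.continuous p.1).comp continuous_fst).mul ((hφ.continuous p.2).comp continuous_snd)

lemma inner_outerTransform (φ : Fin q → I → ℝ) (u v : I) (t : EuclideanSpace ℝ (Fin q × Fin q)) :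
    inner ℝ (outerTransform φ u v) t = ∑ p, t p * (φ p.1 u * φ p.2 v) := by
  simp [PiLp.inner_apply, outerTransform]

lemma IsTransform.integral_inner_outerTransform {φ : Fin q → I → ℝ} (hφ : IsTransform φ)
    (t : EuclideanSpace ℝ (Fin q × Fin q)) :
    ∫ p : I × I, inner ℝ (outerTransform φ p.1 p.2) t = 0 := by
  have hint : ∀ a : Fin q × Fin q, Integrable fun p : I × I => t a * (φ a.1 p.1 * φ a.2 p.2) :=
    fun a => ((hφ.integrable a.1).mul_prod (hφ.integrable a.2)).const_mul (t a)
  simp_rw [inner_outerTransform]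
  rw [integral_finsetSum _ fun a _ => hint a]
  refine Finset.sum_eq_zero fun p _ => ?_
  rw [integral_const_mul]
  have := integral_prod_mul (μ := (volume : Measure I)) (ν := (volume : Measure I)) (φ p.1) (φ p.2)
  rw [hφ.integral_eq_zero, zero_mul] at this
  rw [Measure.volume_eq_prod, this, mul_zero]

/-- After expanding the square, Fubini separates the two coordinates, and each product of two
integrals is an entry of `Σ ⊗ Σ`. -/
lemma IsTransform.integral_sq_inner_outerTransform {φ : Fin q → I → ℝ} (hφ : IsTransform φ)
    (t : EuclideanSpace ℝ (Fin q × Fin q)) :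
    ∫ p : I × I, inner ℝ (outerTransform φ p.1 p.2) t ^ 2
      = t ⬝ᵥ (covMatrix φ ⊗ₖ covMatrix φ) *ᵥ t := by
  have e : ∀ p : I × I, inner ℝ (outerTransform φ p.1 p.2) t ^ 2
      = ∑ a, ∑ b, t a * t b * ((φ a.1 p.1 * φ b.1 p.1) * (φ a.2 p.2 * φ b.2 p.2)) := fun p => by
    rw [inner_outerTransform, sq, Finset.sum_mul_sum]
    exact Finset.sum_congr rfl fun a _ => Finset.sum_congr rfl fun b _ => by ring
  have hint : ∀ a b : Fin q × Fin q, Integrable fun p : I × I =>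
      t a * t b * ((φ a.1 p.1 * φ b.1 p.1) * (φ a.2 p.2 * φ b.2 p.2)) := fun a b =>
    ((hφ.integrable_mul a.1 b.1).mul_prod (hφ.integrable_mul a.2 b.2)).const_mul _
  simp_rw [e]
  rw [integral_finsetSum _ fun a _ => integrable_finsetSum _ fun b _ => hint a b]
  simp only [dotProduct, Matrix.mulVec, Finset.mul_sum]
  refine Finset.sum_congr rfl fun a _ => ?_
  rw [integral_finsetSum _ fun b _ => hint a b]
  refine Finset.sum_congr rfl fun b _ => ?_
  rw [integral_const_mul, Matrix.kroneckerMap_apply]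
  have := integral_prod_mul (μ := (volume : Measure I)) (ν := (volume : Measure I))
    (fun u => φ a.1 u * φ b.1 u) fun v => φ a.2 v * φ b.2 v
  rw [Measure.volume_eq_prod, this]
  simp only [covMatrix]
  ring

lemma IsTransform.exists_norm_outerTransform_le {φ : Fin q → I → ℝ} (hφ : IsTransform φ) :
    ∃ C : ℝ, ∀ u v, ‖outerTransform φ u v‖ ≤ C := by
  obtain ⟨C, hC⟩ := (isCompact_univ (X := I × I)).exists_bound_of_continuousOn
    hφ.continuous_outerTransform.continuousOn
  exact ⟨C, fun u v => hC (u, v) (Set.mem_univ _)⟩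

/-- If `(G, G')` is uniform on the square, a statistic close to the normalized sum of
`φ(G) φ(G')ᵀ` is asymptotically normal with covariance `Σ ⊗ Σ`. -/
lemma IsTransform.tendstoInDistribution_of_map_prod {φ : Fin q → I → ℝ} (hφ : IsTransform φ)
    {Ω : Type} [MeasurableSpace Ω] {P : Measure Ω} [IsProbabilityMeasure P] {G G' : Ω → I}
    (hG : Measurable G) (hG' : Measurable G')
    (hlaw : P.map (fun w => (G w, G' w)) = (volume : Measure (I × I)))
    {T : (n : ℕ) → (Fin n → Ω) → EuclideanSpace ℝ (Fin q × Fin q)} (hT : ∀ n, Measurable (T n))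
    (hconv : ∀ p, VanishesInProb (fun n : ℕ => Measure.pi fun _ : Fin n => P)
      fun n w => (T n w - (√(n : ℝ))⁻¹ • ∑ i, outerTransform φ (G (w i)) (G' (w i))) p) :
    TendstoInDistribution T atTop
      (id : EuclideanSpace ℝ (Fin q × Fin q) → EuclideanSpace ℝ (Fin q × Fin q))
      (fun n => Measure.pi fun _ : Fin n => P)
      (multivariateGaussian 0 (covMatrix φ ⊗ₖ covMatrix φ)) := by
  have hc := hφ.continuous_outerTransform
  have hm := hG.prodMk hG'
  have hΞ : Measurable fun w => outerTransform φ (G w) (G' w) := hc.measurable.comp hm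
  refine tendstoInDistribution_of_sub_normalized_sum hΞ ?_ (posSemidef_covMatrix_kronecker hφ)
    (fun t => ?_) (fun t => ?_) hT
    fun ε hε => tendsto_measure_norm_of_vanishesInProb hconv hε
  · obtain ⟨C, hC⟩ := hφ.exists_norm_outerTransform_le
    exact MemLp.of_bound hΞ.aestronglyMeasurable C (.of_forall fun w => hC _ _)
  · rw [← hφ.integral_inner_outerTransform t, ← hlaw, integral_map hm.aemeasurable]
    exact (hc.inner continuous_const).aestronglyMeasurable
  · rw [← hφ.integral_sq_inner_outerTransform t, ← hlaw, integral_map hm.aemeasurable]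
    exact ((hc.inner continuous_const).pow 2).aestronglyMeasurable

/-- If `G` is a function of `T`, `G'` is uniform and independent of `T`, and `G` is uniform, then
`(G, G')` is uniform on the square. -/
lemma map_prod_eq_volume {Ω α β : Type} [MeasurableSpace Ω] [MeasurableSpace α]
    [MeasurableSpace β] {P : Measure Ω} [IsProbabilityMeasure P] {T : Ω → α} {T' : Ω → β}
    {G G' : Ω → I} {r : α → I} (hr : Measurable r) (hT : Measurable T) (hT' : Measurable T')
    (hG : Measurable G) (hG' : Measurable G') (hrT : ∀ w, r (T w) = G w)
    (hlaw : P.map (fun w => (T' w, G w)) = (P.map T').prod volume)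
    (hlaw' : P.map (fun w => (T w, G' w)) = (P.map T).prod volume) :
    P.map (fun w => (G w, G' w)) = (volume : Measure (I × I)) := by
  have hunif : P.map G = volume := by
    have := Measure.isProbabilityMeasure_map (μ := P) hT'.aemeasurable
    have := congrArg (Measure.map Prod.snd) hlaw
    rwa [Measure.map_map measurable_snd (hT'.prodMk hG), Measure.map_snd_prod, measure_univ,
      one_smul] at this
  have hcomp : r ∘ T = G := funext hrT
  have := Measure.isProbabilityMeasure_map (μ := P) hT.aemeasurable
  have h := congrArg (Measure.map (Prod.map r (id : I → I))) hlaw'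
  rw [Measure.map_map (hr.prodMap measurable_id) (hT.prodMk hG'),
    ← Measure.map_prod_map _ _ hr measurable_id, Measure.map_map hr hT, Measure.map_id, hcomp,
    hunif] at h
  rw [Measure.volume_eq_prod, ← h]
  congr 1
  ext w : 1
  exact congrArg (fun u => (u, G' w)) (hrT w).symm

/-! ### The decomposition of the statistic -/

lemma measurable_scaledStatistic {n : ℕ} {φ : Fin q → I → ℝ} (hφ : IsTransform φ)
    {FX FY : (Fin n → I × Cube d) → I → Cube d → I} (hFX : IsCDFEstimator FX)
    (hFY : IsCDFEstimator FY) : Measurable (scaledStatistic φ FX FY) := by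
  have hsub : ∀ {V : Obs d → I}, Measurable V →
      Measurable fun w : Fin n → Obs d => subsample V w := fun hV =>
    measurable_pi_lambda _ fun i =>
      (hV.comp (measurable_pi_apply i)).prodMk (measurable_zCoord.comp (measurable_pi_apply i))
  have hX : ∀ i, Measurable fun w : Fin n → Obs d => residuals xCoord FX w i := fun i =>
    (hFX.measurable_eval i).comp (hsub measurable_xCoord)
  have hY : ∀ i, Measurable fun w : Fin n → Obs d => residuals yCoord FY w i := fun i =>
    (hFY.measurable_eval i).comp (hsub measurable_yCoord)
  refine (PiLp.continuous_toLp 2 _).measurable.comp (measurable_pi_lambda _ fun p => ?_)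
  refine Measurable.const_mul ?_ _
  simp only [empiricalCorr, Matrix.smul_apply, Matrix.sum_apply, Matrix.vecMulVec_apply, smul_eq_mul]
  refine Measurable.const_mul (Finset.measurable_sum _ fun i _ => ?_) _
  exact ((hφ.continuous p.1).measurable.comp (hX i)).mul
    ((hφ.continuous p.2).measurable.comp (hY i))

/-- This is `a b - α β = (a - α) β + (b - β) α + (a - α) (b - β)`, summed over the sample with `α`,
`β` the transformed true ranks. -/
lemma scaledStatistic_sub_apply (φ : Fin q → I → ℝ) (κX κY : Kernel (Cube d) I)
    (FX FY : (n : ℕ) → (Fin n → I × Cube d) → I → Cube d → I) {n : ℕ} (w : Fin n → Obs d)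
    (p : Fin q × Fin q) :
    (scaledStatistic φ (FX n) (FY n) w - (√(n : ℝ))⁻¹ • ∑ i, outerTransform φ
        (condRank κX (xCoord (w i)) (zCoord (w i))) (condRank κY (yCoord (w i)) (zCoord (w i)))) p
      = (√(n : ℝ))⁻¹ * ∑ i, rankError φ κX FX p.1 n (subsample xCoord w) i
            * φ p.2 (condRank κY (yCoord (w i)) (zCoord (w i)))
        + (√(n : ℝ))⁻¹ * ∑ i, rankError φ κY FY p.2 n (subsample yCoord w) i
            * φ p.1 (condRank κX (xCoord (w i)) (zCoord (w i)))
        + (√(n : ℝ))⁻¹ * ∑ i, rankError φ κX FX p.1 n (subsample xCoord w) i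
            * rankError φ κY FY p.2 n (subsample yCoord w) i := by
  have hs : √(n : ℝ) * (n : ℝ)⁻¹ = (√(n : ℝ))⁻¹ := by
    rw [← div_eq_mul_inv, Real.sqrt_div_self]
  simp only [scaledStatistic, empiricalCorr, outerTransform, rankError, residuals, subsample,
    PiLp.sub_apply, PiLp.smul_apply, WithLp.ofLp_sum, Finset.sum_apply, Matrix.smul_apply,
    Matrix.sum_apply, Matrix.vecMulVec_apply, smul_eq_mul]
  rw [← mul_assoc, hs, ← mul_sub, ← mul_add, ← mul_add, ← Finset.sum_sub_distrib,
    ← Finset.sum_add_distrib, ← Finset.sum_add_distrib]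
  congr 1
  exact Finset.sum_congr rfl fun i _ => by ring

end PartialCopula

open PartialCopula
theorem theorem4p3 {d q : ℕ} (φ : Fin q → I → ℝ) (hφ : IsTransform φ)
    (P₀ : Set (ProbabilityMeasure (Obs d)))
    (hP₀ : P₀ ⊆ acDistributions d)
    (κX κY : ProbabilityMeasure (Obs d) → Kernel (Cube d) I)
    (hκX : ∀ P ∈ P₀, IsCondDistribution (P : Measure (Obs d))
      xCoord (κX P))
    (hκY : ∀ P ∈ P₀, IsCondDistribution (P : Measure (Obs d))
      yCoord (κY P))
    (FX FY : (n : ℕ) → (Fin n → I × Cube d) → I → Cube d → I)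
    (hFX : ∀ n, IsCDFEstimator (FX n))
    (hFY : ∀ n, IsCDFEstimator (FY n))
    (hcons : ∀ P ∈ P₀, ∃ (g h : ℕ → ℝ) (ξ ξ' : I → Cube d → ℝ),
      Tendsto g atTop (𝓝 0) ∧ Tendsto h atTop (𝓝 0) ∧
      IsConsistentAtRate φ P xCoord (κX P) FX ξ g ∧
      IsConsistentAtRate φ P yCoord (κY P) FY ξ' h ∧
      Tendsto (fun n : ℕ => √(n : ℝ) * g n * h n) atTop (𝓝 0)) :
    ∀ P ∈ P₀ ∩ condIndepDistributions d,
      TendstoInDistribution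
        (fun n => scaledStatistic φ (FX n) (FY n)) atTop
        (id : EuclideanSpace ℝ (Fin q × Fin q) → EuclideanSpace ℝ (Fin q × Fin q))
        (fun n => sampleLaw P n)
        (multivariateGaussian 0 (covMatrix φ ⊗ₖ covMatrix φ)) := by
  rintro P ⟨hP, hPac, hind⟩
  obtain ⟨g, h, ξ, ξ', hg, hh, hX, hY, hgh⟩ := hcons P hP
  have hMX := (hκX P hP).isMarkov
  have hMY := (hκY P hP).isMarkov
  have hnaX := (hκX P hP).ae_singleton_eq_zero hPac measurable_xCoord volume_map_zCoord_xCoord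
  have hnaY := (hκY P hP).ae_singleton_eq_zero hPac measurable_yCoord volume_map_zCoord_yCoord
  have hlawY := (hκY P hP).map_prod_condRank measurable_xCoord measurable_yCoord hind hnaY
  have hlawX := (hκX P hP).map_prod_condRank measurable_yCoord measurable_xCoord hind.symm hnaX
  have hGX : Measurable fun w : Obs d => condRank (κX P) (xCoord w) (zCoord w) :=
    measurable_xCoord.condRank measurable_zCoord
  have hGY : Measurable fun w : Obs d => condRank (κY P) (yCoord w) (zCoord w) :=
    measurable_yCoord.condRank measurable_zCoord
  have hTX : Measurable fun w : Obs d => (xCoord w, zCoord w) :=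
    measurable_xCoord.prodMk measurable_zCoord
  have hTY : Measurable fun w : Obs d => (yCoord w, zCoord w) :=
    measurable_yCoord.prodMk measurable_zCoord
  have hjoint := map_prod_eq_volume measurable_condRank hTX hTY hGX hGY (fun _ => rfl)
    hlawX hlawY
  refine hφ.tendstoInDistribution_of_map_prod hGX hGY hjoint
    (fun n => measurable_scaledStatistic hφ (hFX n) (hFY n)) fun p => ?_
  simp_rw [scaledStatistic_sub_apply φ (κX P) (κY P) FX FY]
  -- Each cross term pairs the error of one estimator with the rank of the other variable, which is
  -- independent of that estimator's data; only the product of errors uses `hgh`.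
  refine ((hX.vanishesInProb_cross hφ measurable_xCoord hGY hFX hg hnaX hlawY p.1 p.2).add
    (hY.vanishesInProb_cross hφ measurable_yCoord hGX hFY hh hnaY hlawX p.2 p.1)).add ?_
  exact (hX.isUniformBigOInProb_rankError hφ hFX hnaX p.1).vanishesInProb_sum_mul
    (hY.isUniformBigOInProb_rankError hφ hFY hnaY p.2) hgh
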